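/- Let $\mathfrak{A}$ be a countably infinite set. An argumentation framework (AF) is a pair $F=(A,R)$ where $A\subseteq\mathfrak{A}$ is non-empty and finite and $R\subseteq A\times A$ (the attack relation). $F$ is connected if the undirected graph on $A$ that joins distinct $a,b$ whenever $(a,b)\in R$ or $(b,a)\in R$ is connected. For $S\subseteq A$ say that $S$ attacks $b$ if $(s,b)\in R$ for some $s\in S$, and let $S^+=S\cup\{b : S\text{ attacks } b\}$. The set $S$ is conflict-free if there are no $a,b\in S$ with $(a,b)\in R$; it is admissible if it is conflict-free and attacks every $b\in A$ that attacks some element of $S$. A conflict-free set $S$ is: naive if no conflict-free $T$ satisfies $T\supsetneq S$; stable if $S$ attacks every $a\in A\setminus S$; stage if no conflict-free $T$ satisfies $T^+\supsetneq S^+$; preferred if $S$ is admissible and no admissible $T$ satisfies $T\supsetneq S$; semi-stable if $S$ is admissible and no admissible $T$ satisfies $T^+\supsetneq S^+$. Let $\sigma$ be any one of these five semantics, and let $\sigma(F)$ denote the set of all $S\subseteq A$ of the corresponding kind. For $n\in\mathbb{N}$ put \[ \sigma_{\max}^{\mathrm{con}}(n)=\max\{\,|\sigma(F)| : F=(A,R)\text{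 a connected AF with } |A|=n\,\}, \] where for $n=0$, since there is no AF with $0$ arguments, the value is $0$ by convention. **Theorem.** For every $n\ge 1$ the maximum exists, and for every $n\in\mathbb{N}$ \[ \sigma_{\max}^{\mathrm{con}}(n)=\begin{cases} n, & n\le 5,\\ 2\cdot 3^{s-1}+2^{s-1}, & n\ge 6,\ n=3s,\\ 3^{s}+2^{s-1}, & n\ge 6,\ n=3s+1,\\ 4\cdot 3^{s-1}+3\cdot 2^{s-2}, & n\ge 6,\ n=3s+2.\end{cases} \] -/

import Mathlib

/-- An argumentation framework over the domain `𝔄` of arguments: a non-empty finite set of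
arguments together with an arbitrary attack relation on that set. -/
structure AF (𝔄 : Type*) where
  args : Finset 𝔄
  attacks : Set (𝔄 × 𝔄)
  args_nonempty : args.Nonempty
  attacks_subset : ∀ p ∈ attacks, p.1 ∈ args ∧ p.2 ∈ args

namespace AF

variable {𝔄 : Type*}

/-- The set `S` attacks the argument `a` in `F`. -/
def SetAttacks (F : AF 𝔄) (S : Finset 𝔄) (a : 𝔄) : Prop :=
  ∃ s ∈ S, (s, a) ∈ F.attacks

/-- The range of `S`: its elements and everything it attacks. -/
def range (F : AF 𝔄) (S : Finset 𝔄) : Set 𝔄 :=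
  {b | b ∈ S ∨ F.SetAttacks S b}

/-- The argument `a` is defended by `S` in `F`. -/
def Defends (F : AF 𝔄) (S : Finset 𝔄) (a : 𝔄) : Prop :=
  ∀ b ∈ F.args, (b, a) ∈ F.attacks → F.SetAttacks S b

/-- Conflict-free sets of arguments. -/
def cf (F : AF 𝔄) : Set (Finset 𝔄) :=
  {S | S ⊆ F.args ∧ ∀ a ∈ S, ∀ b ∈ S, (a, b) ∉ F.attacks}

/-- Admissible sets of arguments. -/
def adm (F : AF 𝔄) : Set (Finset 𝔄) :=
  {S | S ∈ F.cf ∧ ∀ a ∈ S, F.Defends S a}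

/-- Naive extensions. -/
def naive (F : AF 𝔄) : Set (Finset 𝔄) :=
  {S | S ∈ F.cf ∧ ¬ ∃ T ∈ F.cf, S ⊂ T}

/-- Stable extensions. -/
def stb (F : AF 𝔄) : Set (Finset 𝔄) :=
  {S | S ∈ F.cf ∧ ∀ a ∈ F.args, a ∉ S → F.SetAttacks S a}

/-- Preferred extensions. -/
def pref (F : AF 𝔄) : Set (Finset 𝔄) :=
  {S | S ∈ F.adm ∧ ¬ ∃ T ∈ F.adm, S ⊂ T}

/-- Stage extensions. -/
def stage (F : AF 𝔄) : Set (Finset 𝔄) :=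
  {S | S ∈ F.cf ∧ ¬ ∃ T ∈ F.cf, F.range S ⊂ F.range T}

/-- Semi-stable extensions. -/
def sem (F : AF 𝔄) : Set (Finset 𝔄) :=
  {S | S ∈ F.adm ∧ ¬ ∃ T ∈ F.adm, F.range S ⊂ F.range T}

/-- The undirected loopless graph underlying `F`, on the arguments of `F`. -/
def underlying (F : AF 𝔄) : SimpleGraph {a : 𝔄 // a ∈ F.args} :=
  SimpleGraph.fromRel fun a b => (a.1, b.1) ∈ F.attacks

/-- `F` is (weakly) connected. -/
def Connected (F : AF 𝔄) : Prop :=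
  F.underlying.Connected

end AF

/-- The five semantics under consideration. -/
inductive Semantics
  | naive
  | stb
  | stage
  | sem
  | pref

/-- The set of `σ`-extensions of `F`. -/
def Semantics.extensions {𝔄 : Type*} : Semantics → AF 𝔄 → Set (Finset 𝔄)
  | .naive, F => F.naive
  | .stb, F => F.stb
  | .stage, F => F.stage
  | .sem, F => F.sem
  | .pref, F => F.pref

/-- Every framework has finitely many extensions, so counting them with `Set.ncard` is sound. -/
theorem Semantics.extensions_finite {𝔄 : Type*} (σ : Semantics) (F : AF 𝔄) :
    (σ.extensions F).Finite := by
  refine Set.Finite.subset F.args.powerset.finite_toSet fun S hS => ?_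
  have h : S ∈ F.cf := by
    cases σ
    · exact hS.1
    · exact hS.1
    · exact hS.1
    · exact hS.1.1
    · exact hS.1.1
  simpa using h.1

/-- All numbers `|σ(F)|` for connected frameworks `F` with exactly `n` arguments. -/
def conCounts (𝔄 : Type*) (σ : Semantics) (n : ℕ) : Set ℕ :=
  {k | ∃ F : AF 𝔄, F.args.card = n ∧ F.Connected ∧ (σ.extensions F).ncard = k}

/-- The maximal number of `σ`-extensions of a connected framework with `n` arguments
(`0` if there is no such framework, which happens for `n = 0`). -/
noncomputable def sigmaMaxCon (𝔄 : Type*) (σ : Semantics) (n : ℕ) : ℕ :=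
  sSup (conCounts 𝔄 σ n)

/-! The problem reduces to counting maximal independent sets of a connected graph. Stable and stage
extensions are naive, and semi-stable ones are preferred. Choosing a naive superset of each
preferred set is injective, because two preferred sets inside one conflict-free set have an
admissible union. So naive extensions dominate all five counts (`ncard_extensions_le_ncard_naive`),
and they are maximal independent sets of the attack graph on the arguments that do not attack
themselves. If some argument attacks itself, at most `n - 1` vertices remain and the Moon–Moser
bound suffices (`moonMoser_le_conMax_succ`). Otherwise the graph is connected and
`card_maxIndep_le_conMax` applies. Conversely, in a symmetric framework every maximal independent
set is stable and admissible, hence an extension of each kind, and stars of cliques attain `conMax`.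

The graph theorem goes by induction on the number of vertices. With a cut vertex `b`, a smallest
union `X` of some but not all components of `A - b` is chosen, with `Y` the other components.
Branching on `b` bounds the count by `p * P + q * Q`, where `p`, `P` count in `X`, `Y` and `q`, `Q`
in their parts outside the neighbourhood of `b`. The inequalities for `a * P + Q` in `attached_le`
turn this into a linear optimisation (`leaf_le`, `special_leaf_le`). It fails only in a few residual
cases with `X` of size 4, 6 or 7, and there no vertex of `X` is a cut vertex.

Those cases, and graphs without cut vertices, are settled by `card_maxIndep_le_of_inner`. A non-cut
vertex of large degree is removed by plain branching. If the relevant degrees are only 2 and 3, a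
vertex is chosen that misses a connected set of greatest size. The part of the graph far from it
then obeys the connected bound, which is sharper than Moon–Moser. -/

/-- The maximal number of maximal independent sets of a graph with `n` vertices. -/
def moonMoser : ℕ → ℕ
  | 0 => 1
  | 1 => 1
  | 2 => 2
  | 3 => 3
  | 4 => 4
  | (n + 5) => 3 * moonMoser (n + 2)

/-- The maximal number of maximal independent sets of a connected graph with `n` vertices. -/
def conMax (n : ℕ) : ℕ :=
  if n ≤ 5 then n
  else if n % 3 = 0 then 2 * 3 ^ (n / 3 - 1) + 2 ^ (n / 3 - 1)
  else if n % 3 = 1 then 3 ^ (n / 3) + 2 ^ (n / 3 - 1)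
  else 4 * 3 ^ (n / 3 - 1) + 3 * 2 ^ (n / 3 - 2)

/-! ### Numerical estimates for `moonMoser` and `conMax`. -/

namespace Extremal

theorem moonMoser_add_five (n : ℕ) : moonMoser (n + 5) = 3 * moonMoser (n + 2) := by
  rw [moonMoser]

theorem moonMoser_add_mul {k : ℕ} (hk : 2 ≤ k) (i : ℕ) :
    moonMoser (3 * i + k) = moonMoser k * 3 ^ i := by
  induction i with
  | zero => simp
  | succ i ih =>
    obtain ⟨l, rfl⟩ := Nat.exists_eq_add_of_le' hk
    rw [show 3 * (i + 1) + (l + 2) = 3 * i + l + 5 by ring, moonMoser_add_five,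
      show 3 * i + l + 2 = 3 * i + (l + 2) by ring, ih]; ring

theorem conMax_add_mul {k : ℕ} (hk : 6 ≤ k) (i : ℕ) :
    conMax (3 * i + k) =
      if k % 3 = 0 then 2 * 3 ^ (k / 3 - 1) * 3 ^ i + 2 ^ (k / 3 - 1) * 2 ^ i
      else if k % 3 = 1 then 3 ^ (k / 3) * 3 ^ i + 2 ^ (k / 3 - 1) * 2 ^ i
      else 4 * 3 ^ (k / 3 - 1) * 3 ^ i + 3 * 2 ^ (k / 3 - 2) * 2 ^ i := by
  have h1 : (3 * i + k) / 3 - 1 = k / 3 - 1 + i := by omega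
  have h2 : (3 * i + k) / 3 = k / 3 + i := by omega
  have h3 : (3 * i + k) / 3 - 2 = k / 3 - 2 + i := by omega
  have h4 : (3 * i + k) % 3 = k % 3 := by omega
  rw [conMax, if_neg (by omega), h1, h3, h2, h4]
  simp only [pow_add, mul_assoc]

theorem two_pow_le_three_pow (i : ℕ) : 2 ^ i ≤ 3 ^ i := Nat.pow_le_pow_left (by norm_num) i

/-- In this form both extremal functions are linear in `3 ^ i` and `2 ^ i`, so most estimates below
follow from `two_pow_le_three_pow` by linear arithmetic. -/
theorem exists_of_six_le {n : ℕ} (h : 6 ≤ n) :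
    ∃ i, n = 3 * i + 6 ∨ n = 3 * i + 7 ∨ n = 3 * i + 8 :=
  ⟨n / 3 - 2, by omega⟩

/-- An estimate that survives one step of size three holds for all `n` once it holds three times. -/
theorem induction_three {p : ℕ → Prop} (n₀ : ℕ) (h0 : p n₀) (h1 : p (n₀ + 1)) (h2 : p (n₀ + 2))
    (step : ∀ n, n₀ ≤ n → p n → p (n + 3)) : ∀ n, n₀ ≤ n → p n := by
  intro n
  induction n using Nat.strong_induction_on with
  | _ n ih =>
    intro hn
    rcases (by omega : n = n₀ ∨ n = n₀ + 1 ∨ n = n₀ + 2 ∨ n₀ + 3 ≤ n) with h | h | h | h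
    · rwa [h]
    · rwa [h]
    · rwa [h]
    · have := step (n - 3) (by omega) (ih (n - 3) (by omega) (by omega))
      rwa [show n - 3 + 3 = n by omega] at this

/-- The recursion breaks at `n = 1`, where the values are 4 and 1: two edges beat a triangle with an
isolated vertex. -/
theorem moonMoser_add_three {n : ℕ} (h : 2 ≤ n) : moonMoser (n + 3) = 3 * moonMoser n := by
  obtain ⟨k, rfl⟩ := Nat.exists_eq_add_of_le h
  rw [show 2 + k + 3 = k + 5 by ring, moonMoser_add_five, add_comm k 2]

theorem three_mul_moonMoser_le (n : ℕ) : 3 * moonMoser n ≤ moonMoser (n + 3) := by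
  rcases (by omega : n = 0 ∨ n = 1 ∨ 2 ≤ n) with h | h | h
  · subst h; decide
  · subst h; decide
  · exact (moonMoser_add_three h).ge

theorem moonMoser_le_succ (n : ℕ) : moonMoser n ≤ moonMoser (n + 1) := by
  rcases (by omega : n = 0 ∨ n = 1 ∨ 2 ≤ n) with h | h | h
  · subst h; decide
  · subst h; decide
  · refine induction_three (p := fun n => moonMoser n ≤ moonMoser (n + 1)) 2 (by decide) (by decide)
      (by decide) ?_ n h
    intro n hn ih
    rw [show n + 3 + 1 = n + 1 + 3 by ring, moonMoser_add_three hn,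
      moonMoser_add_three (by omega)]; omega

theorem moonMoser_mono : Monotone moonMoser := monotone_nat_of_le_succ moonMoser_le_succ

theorem two_mul_moonMoser_le (n : ℕ) : 2 * moonMoser n ≤ moonMoser (n + 2) := by
  rcases (by omega : n = 0 ∨ n = 1 ∨ 2 ≤ n) with h | h | h
  · subst h; decide
  · subst h; decide
  · refine induction_three (p := fun n => 2 * moonMoser n ≤ moonMoser (n + 2)) 2 (by decide)
      (by decide) (by decide) ?_ n h
    intro n hn ih
    rw [show n + 3 + 2 = n + 2 + 3 by ring, moonMoser_add_three hn,
      moonMoser_add_three (by omega)]; omega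

theorem four_mul_moonMoser_le (n : ℕ) : 4 * moonMoser n ≤ moonMoser (n + 4) := by
  have h1 := two_mul_moonMoser_le n
  have h2 := two_mul_moonMoser_le (n + 2)
  rw [show n + 2 + 2 = n + 4 by ring] at h2
  omega

/-- Supermultiplicativity of the Moon–Moser numbers. -/
theorem moonMoser_mul_le (a b : ℕ) : moonMoser a * moonMoser b ≤ moonMoser (a + b) := by
  induction a using Nat.strong_induction_on with
  | _ a ih =>
    rcases (by omega : a = 0 ∨ a = 1 ∨ a = 2 ∨ a = 3 ∨ a = 4 ∨ 5 ≤ a) with h | h | h | h | h | h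
    · subst h; simp [moonMoser]
    · subst h; rw [show moonMoser 1 = 1 from rfl, one_mul, add_comm]; exact moonMoser_le_succ b
    · subst h; rw [add_comm 2 b]; exact two_mul_moonMoser_le b
    · subst h; rw [add_comm 3 b]; exact three_mul_moonMoser_le b
    · subst h; rw [add_comm 4 b]; exact four_mul_moonMoser_le b
    · obtain ⟨k, rfl⟩ := Nat.exists_eq_add_of_le' h
      have h1 := ih (k + 2) (by omega)
      have h2 := three_mul_moonMoser_le (k + 2 + b)
      rw [moonMoser_add_five, mul_assoc]
      rw [show k + 2 + b + 3 = k + 5 + b by ring] at h2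
      omega

theorem le_moonMoser (k : ℕ) (h : 1 ≤ k) : k ≤ moonMoser k := by
  rcases (by omega : k = 1 ∨ 2 ≤ k) with rfl | h
  · decide
  refine induction_three (p := fun n => n ≤ moonMoser n) 2 (by decide) (by decide) (by decide)
    ?_ k h
  intro n hn ih
  have := three_mul_moonMoser_le n
  omega

theorem mul_moonMoser_le {k n : ℕ} (h : 1 ≤ k) : k * moonMoser n ≤ moonMoser (k + n) :=
  (Nat.mul_le_mul_right _ (le_moonMoser k h)).trans (moonMoser_mul_le k n)


theorem conMax_le_succ (n : ℕ) : conMax n ≤ conMax (n + 1) := by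
  rcases lt_or_ge n 6 with h | h
  · interval_cases n <;> decide
  · obtain ⟨i, rfl | rfl | rfl⟩ := exists_of_six_le h <;> have := two_pow_le_three_pow i <;>
      simp [add_assoc, conMax_add_mul] <;> omega

theorem conMax_mono : Monotone conMax := monotone_nat_of_le_succ conMax_le_succ

theorem conMax_le_moonMoser (n : ℕ) : conMax n ≤ moonMoser n := by
  rcases lt_or_ge n 6 with h | h
  · interval_cases n <;> decide
  · obtain ⟨i, rfl | rfl | rfl⟩ := exists_of_six_le h <;> have := two_pow_le_three_pow i <;>
      simp [add_assoc, conMax_add_mul, moonMoser_add_mul, moonMoser] <;> omega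

/-- One extra vertex pays for connectedness. This disposes of self-attacking arguments and makes the
excess in `attach_step` nonnegative. -/
theorem moonMoser_le_conMax_succ (n : ℕ) : moonMoser n ≤ conMax (n + 1) := by
  rcases lt_or_ge n 6 with h | h
  · interval_cases n <;> decide
  · obtain ⟨i, rfl | rfl | rfl⟩ := exists_of_six_le h <;> have := two_pow_le_three_pow i <;>
      simp [add_assoc, conMax_add_mul, moonMoser_add_mul, moonMoser] <;> omega

/-- The count behind it: a triangle is hung by one edge at a vertex `u` of a connected graph. Either
of the two free triangle vertices leaves that graph intact, and the third removes `u`. -/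
theorem two_mul_conMax_add_le {n : ℕ} (h : 1 ≤ n) :
    2 * conMax (n + 1) + moonMoser n ≤ conMax (n + 4) := by
  rcases lt_or_ge n 6 with h' | h'
  · interval_cases n <;> decide
  · obtain ⟨i, rfl | rfl | rfl⟩ := exists_of_six_le h' <;> have := two_pow_le_three_pow i <;>
      simp [add_assoc, conMax_add_mul, moonMoser_add_mul, moonMoser] <;> omega

/-- The converse fails at `n = 4`, where it would read `15 ≤ 14`. -/
theorem conMax_add_four_le {n : ℕ} (h : 1 ≤ n) (h4 : n ≠ 4) :
    conMax (n + 4) ≤ 2 * conMax (n + 1) + moonMoser n := by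
  rcases lt_or_ge n 8 with h' | h'
  · interval_cases n <;> revert h4 <;> decide
  · obtain ⟨i, rfl | rfl | rfl⟩ := exists_of_six_le (by omega : 6 ≤ n) <;>
      have := two_pow_le_three_pow i <;>
      simp [add_assoc, conMax_add_mul, moonMoser_add_mul, moonMoser] <;> omega

/-- These are the cases `h = 1, 3, 4, 7` of `attach_le` after cancellation. -/
theorem attach_base {M : ℕ} (h : 1 ≤ M) :
    conMax (M + 1) + moonMoser M ≤ conMax (M + 3) ∧
    3 * conMax (M + 1) + moonMoser M ≤ conMax (M + 5) ∧
    4 * conMax (M + 1) + moonMoser M ≤ conMax (M + 6) ∧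
    12 * conMax (M + 1) + 3 * moonMoser M ≤ conMax (M + 9) := by
  rcases lt_or_ge M 6 with h' | h'
  · interval_cases M <;> decide
  · obtain ⟨i, rfl | rfl | rfl⟩ := exists_of_six_le h' <;> have := two_pow_le_three_pow i <;>
      refine ⟨?_, ?_, ?_, ?_⟩ <;>
      simp [add_assoc, conMax_add_mul, moonMoser_add_mul, moonMoser] <;> omega

/-- The numerical estimate behind attaching one more component to a cut vertex. -/
theorem attach_le (h : ℕ) {M : ℕ} (hM : 1 ≤ M) :
    moonMoser h * conMax (M + 1) + conMax (h + 1) * moonMoser M ≤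
      conMax (M + h + 2) + moonMoser h * moonMoser M := by
  obtain ⟨b1, b3, b4, b7⟩ := attach_base hM
  induction h using Nat.strong_induction_on with
  | _ h ih =>
    rcases (by omega : h = 0 ∨ h = 1 ∨ h = 2 ∨ h = 3 ∨ h = 4 ∨ h = 7 ∨
      (5 ≤ h ∧ h ≠ 7)) with h0 | h0 | h0 | h0 | h0 | h0 | ⟨h0, h7⟩
    · subst h0; have := conMax_le_succ (M + 1); simp [moonMoser, conMax, add_assoc] at *; omega
    · subst h0; simp [moonMoser, conMax, add_assoc] at *; omega
    · subst h0; have := two_mul_conMax_add_le hM; simp [moonMoser, conMax, add_assoc] at *; omega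
    · subst h0
      rw [show moonMoser 3 = 3 from rfl, show conMax (3 + 1) = 4 from rfl,
        show M + 3 + 2 = M + 5 from rfl]; omega
    · subst h0
      rw [show moonMoser 4 = 4 from rfl, show conMax (4 + 1) = 5 from rfl,
        show M + 4 + 2 = M + 6 from rfl]; omega
    · subst h0
      rw [show moonMoser 7 = 12 from rfl, show conMax (7 + 1) = 15 from rfl,
        show M + 7 + 2 = M + 9 from rfl]; omega
    -- The step from `k` to `k + 3` uses the induction hypothesis twice, together with the
    -- recurrence for `conMax`. That recurrence fails at `k = 4`, which is why `h = 7` is a base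
    -- case.
    · obtain ⟨k, rfl⟩ := Nat.exists_eq_add_of_le' (by omega : 3 ≤ h)
      have e1 := ih k (by omega)
      have e2 := conMax_add_four_le (n := k) (by omega) (by omega)
      have e3 := moonMoser_add_three (n := k) (by omega)
      have e4 : moonMoser k * conMax (M + 1) ≤ moonMoser (M + k + 1) := by
        refine (Nat.mul_le_mul_left _ (conMax_le_moonMoser _)).trans ?_
        rw [show M + k + 1 = k + (M + 1) by ring]
        exact moonMoser_mul_le _ _
      have e5 := two_mul_conMax_add_le (n := M + k + 1) (by omega)
      rw [show k + 3 + 1 = k + 4 by ring, show M + (k + 3) + 2 = M + k + 1 + 4 by ring, e3]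
      have e6 := Nat.mul_le_mul_right (moonMoser M) e2
      rw [show M + k + 1 + 1 = M + k + 2 by ring] at e5
      nlinarith

/-- Attaching a component with `p` and `q` as counts, in terms of the counts `P`, `Q` so far. -/
theorem attach_step {a y h P Q p q : ℕ} (ha : 1 ≤ a) (hh : 1 ≤ h) (hP : P ≤ moonMoser y)
    (hPQ : a * P + Q ≤ conMax (y + a + 1)) (hp : p ≤ conMax h) (hq : q ≤ moonMoser (h - 1)) :
    a * (P * p) + Q * q ≤ conMax (y + h + a + 1) := by
  obtain ⟨k, rfl⟩ := Nat.exists_eq_add_of_le' hh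
  rw [Nat.add_sub_cancel] at hq
  have h1 := attach_le k (M := y + a) (by omega)
  have h2 : a * P ≤ moonMoser (y + a) :=
    (Nat.mul_le_mul_left a hP).trans ((mul_moonMoser_le ha).trans (by rw [add_comm]))
  -- With `e` the excess of `conMax (k + 1)` over `moonMoser k`, the left side is at most `moonMoser
  -- k * (a * P + Q) + e * (a * P)`, and both brackets are bounded.
  obtain ⟨e, he⟩ := Nat.exists_eq_add_of_le (moonMoser_le_conMax_succ k)
  rw [he] at h1 hp
  rw [show y + a + k + 2 = y + (k + 1) + a + 1 by ring] at h1
  have h3 := Nat.mul_le_mul_left (a * P) hp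
  have h4 := Nat.mul_le_mul_left Q hq
  have h5 := Nat.mul_le_mul_right e h2
  have h6 := Nat.mul_le_mul_left (moonMoser k) hPQ
  nlinarith

/-- The first inequality is `(3 ^ i - 2 ^ i) * (3 ^ j - 2 ^ j) ≥ 0` expanded. -/
theorem three_two_pow_products (i j : ℕ) :
    3 ^ i * 2 ^ j + 2 ^ i * 3 ^ j ≤ 3 ^ i * 3 ^ j + 2 ^ i * 2 ^ j ∧
    2 ^ i * 2 ^ j ≤ 3 ^ i * 2 ^ j ∧ 2 ^ i * 2 ^ j ≤ 2 ^ i * 3 ^ j := by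
  refine ⟨?_, Nat.mul_le_mul_right _ (two_pow_le_three_pow i),
    Nat.mul_le_mul_left _ (two_pow_le_three_pow j)⟩
  obtain ⟨e, he⟩ := Nat.exists_eq_add_of_le (two_pow_le_three_pow i)
  obtain ⟨f, hf⟩ := Nat.exists_eq_add_of_le (two_pow_le_three_pow j)
  rw [he, hf]
  nlinarith [Nat.zero_le (e * f)]

/-- Linear programming duality: `c * P + g * Q` equals `(2g - c)(P + Q) + (c - g)(2P + Q)`, with
nonnegative multipliers. The form avoids subtraction. -/
theorem combine_le {c g P Q U W : ℕ} (h1 : c ≤ 2 * g) (h2 : g ≤ c) (hU : P + Q ≤ U)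
    (hW : 2 * P + Q ≤ W) : c * P + g * Q + c * U + g * W ≤ 2 * g * U + c * W := by
  obtain ⟨β, rfl⟩ := Nat.exists_eq_add_of_le h2
  obtain ⟨α, rfl⟩ := Nat.exists_eq_add_of_le (by omega : β ≤ g)
  have := Nat.mul_le_mul_left α hU
  have := Nat.mul_le_mul_left β hW
  nlinarith

/-- These serve `leaf_le` for `x = 4` and `x = 5`. For `y` divisible by 3 the first can fail: `y =
6` gives 44 against 42. -/
theorem small_leaf_le {y : ℕ} (hy : 4 ≤ y) :
    (y % 3 ≠ 0 → 2 * conMax (y + 3) ≤ conMax (y + 5)) ∧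
    (5 ≤ y → conMax (y + 2) + 2 * conMax (y + 3) ≤ conMax (y + 6)) := by
  rcases lt_or_ge y 6 with h' | h'
  · interval_cases y <;> decide
  · obtain ⟨i, rfl | rfl | rfl⟩ := exists_of_six_le h' <;> have := two_pow_le_three_pow i <;>
      refine ⟨?_, ?_⟩ <;>
      simp [add_assoc, conMax_add_mul] <;> omega

theorem leaf_coeff_bounds (n : ℕ) (h : 6 ≤ n) :
    conMax n ≤ 2 * moonMoser (n - 2) ∧ moonMoser (n - 2) ≤ conMax n := by
  constructor
  · obtain ⟨i, rfl | rfl | rfl⟩ := exists_of_six_le h <;> have := two_pow_le_three_pow i <;>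
      simp [conMax_add_mul, moonMoser_add_mul, moonMoser] <;> omega
  · exact (moonMoser_mono (by omega)).trans ((moonMoser_le_conMax_succ (n - 1)).trans
      (by rw [Nat.sub_add_cancel (by omega)]))

theorem leaf_le {x y P Q : ℕ} (hx : 4 ≤ x) (hxy : x ≤ y)
    (hexc : (x + y) % 3 = 1 → x ≠ 4 ∧ x ≠ 6 ∧ x ≠ 7)
    (h1 : P + Q ≤ conMax (y + 2)) (h2 : 2 * P + Q ≤ conMax (y + 3)) :
    conMax x * P + moonMoser (x - 2) * Q ≤ conMax (x + y + 1) := by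
  rcases (by omega : x = 4 ∨ x = 5 ∨ 6 ≤ x) with rfl | h5 | h6
  · have := (small_leaf_le hxy).1 (by omega)
    rw [show conMax 4 = 4 from rfl, show moonMoser (4 - 2) = 2 from rfl,
      show 4 + y + 1 = y + 5 by ring]; omega
  · have := (small_leaf_le (hx.trans hxy)).2 (by omega)
    subst h5
    rw [show conMax 5 = 5 from rfl, show moonMoser (5 - 2) = 3 from rfl,
      show 5 + y + 1 = y + 6 by ring]; omega
  · obtain ⟨hc1, hc2⟩ := leaf_coeff_bounds x h6
    have key := combine_le hc1 hc2 h1 h2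
    clear h1 h2 hc1 hc2
    suffices 2 * moonMoser (x - 2) * conMax (y + 2) + conMax x * conMax (y + 3) ≤
      conMax (x + y + 1) + conMax x * conMax (y + 2) + moonMoser (x - 2) * conMax (y + 3) by omega
    clear key
    obtain ⟨i, hi⟩ := exists_of_six_le h6
    obtain ⟨j, hj⟩ := exists_of_six_le (h6.trans hxy)
    rcases hi with rfl | rfl | rfl <;> rcases hj with rfl | rfl | rfl
    · rw [show 3 * i + 6 + (3 * j + 6) + 1 = 3 * (i + j) + 13 by ring]
      obtain ⟨q1, q2, q3⟩ := three_two_pow_products i j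
      simp [add_assoc, conMax_add_mul, moonMoser_add_mul, moonMoser, pow_add]
      nlinarith [Nat.zero_le (2 ^ i * 2 ^ j)]
    -- `i = 0` is an excluded exceptional size of the smaller part. Then `x ≤ y` rules out `j = 0`,
    -- so both indices can be shifted.
    · rcases i with _ | i
      · omega
      rcases j with _ | j
      · omega
      rw [show 3 * (i + 1) + 6 + (3 * (j + 1) + 7) + 1 = 3 * (i + j) + 20 by ring,
        show 3 * (i + 1) + 6 = 3 * i + 9 by ring,
        show 3 * (j + 1) + 7 = 3 * j + 10 by ring]
      obtain ⟨q1, q2, q3⟩ := three_two_pow_products i j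
      simp [add_assoc, conMax_add_mul, moonMoser_add_mul, moonMoser, pow_add]
      nlinarith [Nat.zero_le (2 ^ i * 2 ^ j)]
    · rw [show 3 * i + 6 + (3 * j + 8) + 1 = 3 * (i + j) + 15 by ring]
      obtain ⟨q1, q2, q3⟩ := three_two_pow_products i j
      simp [add_assoc, conMax_add_mul, moonMoser_add_mul, moonMoser, pow_add]
      nlinarith [Nat.zero_le (2 ^ i * 2 ^ j)]
    · rcases i with _ | i
      · omega
      rcases j with _ | j
      · omega
      rw [show 3 * (i + 1) + 7 + (3 * (j + 1) + 6) + 1 = 3 * (i + j) + 20 by ring,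
        show 3 * (i + 1) + 7 = 3 * i + 10 by ring,
        show 3 * (j + 1) + 6 = 3 * j + 9 by ring]
      obtain ⟨q1, q2, q3⟩ := three_two_pow_products i j
      simp [add_assoc, conMax_add_mul, moonMoser_add_mul, moonMoser, pow_add]
      nlinarith [Nat.zero_le (2 ^ i * 2 ^ j)]
    · rw [show 3 * i + 7 + (3 * j + 7) + 1 = 3 * (i + j) + 15 by ring]
      obtain ⟨q1, q2, q3⟩ := three_two_pow_products i j
      simp [add_assoc, conMax_add_mul, moonMoser_add_mul, moonMoser, pow_add]
      nlinarith [Nat.zero_le (2 ^ i * 2 ^ j)]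
    · rw [show 3 * i + 7 + (3 * j + 8) + 1 = 3 * (i + j) + 16 by ring]
      obtain ⟨q1, q2, q3⟩ := three_two_pow_products i j
      simp [add_assoc, conMax_add_mul, moonMoser_add_mul, moonMoser, pow_add]
      nlinarith [Nat.zero_le (2 ^ i * 2 ^ j)]
    · rw [show 3 * i + 8 + (3 * j + 6) + 1 = 3 * (i + j) + 15 by ring]
      obtain ⟨q1, q2, q3⟩ := three_two_pow_products i j
      simp [add_assoc, conMax_add_mul, moonMoser_add_mul, moonMoser, pow_add]
      nlinarith [Nat.zero_le (2 ^ i * 2 ^ j)]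
    · rw [show 3 * i + 8 + (3 * j + 7) + 1 = 3 * (i + j) + 16 by ring]
      obtain ⟨q1, q2, q3⟩ := three_two_pow_products i j
      simp [add_assoc, conMax_add_mul, moonMoser_add_mul, moonMoser, pow_add]
      nlinarith [Nat.zero_le (2 ^ i * 2 ^ j)]
    · rw [show 3 * i + 8 + (3 * j + 8) + 1 = 3 * (i + j) + 17 by ring]
      obtain ⟨q1, q2, q3⟩ := three_two_pow_products i j
      simp [add_assoc, conMax_add_mul, moonMoser_add_mul, moonMoser, pow_add]
      nlinarith [Nat.zero_le (2 ^ i * 2 ^ j)]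

/-- The estimates for a cut-off part with `4`, `6` or `7` vertices. -/
theorem special_leaf_le {x y P Q p q : ℕ} (hx : x = 4 ∨ x = 6 ∨ x = 7) (hxy : x ≤ y)
    (hmod : (x + y) % 3 = 1) (hP : P ≤ moonMoser y) (h1 : P + Q ≤ conMax (y + 2))
    (h2 : 2 * P + Q ≤ conMax (y + 3))
    (h : p ≤ conMax x ∧ q ≤ moonMoser (x - 3) ∨
      p ≤ moonMoser (x - 2) + moonMoser (x - 3) ∧ q ≤ moonMoser (x - 2)) :
    p * P + q * Q ≤ conMax (x + y + 1) := by
  -- The coefficients come from writing the first objective as a combination of `2P + Q` and `P`,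
  -- and the second as one of `P + Q` and `2P + Q`.
  have key : moonMoser (x - 3) * conMax (y + 3) + (conMax x - 2 * moonMoser (x - 3)) * moonMoser y
      ≤ conMax (x + y + 1) ∧ (moonMoser (x - 2) - moonMoser (x - 3)) * conMax (y + 2) +
      moonMoser (x - 3) * conMax (y + 3) ≤ conMax (x + y + 1) := by
    rcases lt_or_ge y 6 with h' | h'
    · rcases hx with rfl | rfl | rfl <;> interval_cases y <;> omega
    · obtain ⟨i, hi⟩ := exists_of_six_le h'
      have := two_pow_le_three_pow i
      rcases hx with rfl | rfl | rfl
      · obtain rfl : y = 3 * i + 6 := by omega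
        rw [show 4 + (3 * i + 6) + 1 = 3 * i + 11 by ring, show conMax 4 = 4 from rfl]
        simp [add_assoc, conMax_add_mul, moonMoser_add_mul, moonMoser]
        omega
      · obtain rfl : y = 3 * i + 7 := by omega
        rw [show 6 + (3 * i + 7) + 1 = 3 * i + 14 by ring, show conMax 6 = 8 from rfl]
        simp [add_assoc, conMax_add_mul, moonMoser_add_mul, moonMoser]
        omega
      · obtain rfl : y = 3 * i + 6 := by omega
        rw [show 7 + (3 * i + 6) + 1 = 3 * i + 14 by ring, show conMax 7 = 11 from rfl]
        simp [add_assoc, conMax_add_mul, moonMoser_add_mul, moonMoser]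
        omega
  obtain ⟨k1, k2⟩ := key
  rcases h with ⟨hp, hq⟩ | ⟨hp, hq⟩
  · have a1 := Nat.mul_le_mul_right P hp
    have a2 := Nat.mul_le_mul_right Q hq
    rcases hx with rfl | rfl | rfl <;>
      simp [moonMoser, show conMax 4 = 4 from rfl, show conMax 6 = 8 from rfl,
        show conMax 7 = 11 from rfl] at * <;> nlinarith
  · have a1 := Nat.mul_le_mul_right P hp
    have a2 := Nat.mul_le_mul_right Q hq
    rcases hx with rfl | rfl | rfl <;>
      simp [moonMoser] at * <;> nlinarith

theorem noncut_four_le {n : ℕ} (h : 5 ≤ n) : conMax (n - 1) + moonMoser (n - 5) ≤ conMax n := by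
  obtain ⟨n, rfl⟩ := Nat.exists_eq_add_of_le' h
  rcases lt_or_ge n 6 with h' | h'
  · interval_cases n <;> decide
  · obtain ⟨i, rfl | rfl | rfl⟩ := exists_of_six_le h' <;> have := two_pow_le_three_pow i <;>
      simp [add_assoc, conMax_add_mul, moonMoser_add_mul, moonMoser] at * <;> omega

theorem noncut_three_le {n : ℕ} (h : 5 ≤ n) (h3 : n % 3 ≠ 2) :
    conMax (n - 1) + moonMoser (n - 4) ≤ conMax n := by
  obtain ⟨n, rfl⟩ := Nat.exists_eq_add_of_le' h
  rcases lt_or_ge n 6 with h' | h'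
  · interval_cases n <;> revert h3 <;> decide
  · obtain ⟨i, rfl | rfl | rfl⟩ := exists_of_six_le h' <;> have := two_pow_le_three_pow i <;>
      simp [add_assoc, conMax_add_mul, moonMoser_add_mul, moonMoser] at * <;> omega

theorem chain_le {n : ℕ} (h : 5 ≤ n) : 2 * conMax (n - 3) + conMax (n - 4) ≤ conMax n := by
  obtain ⟨n, rfl⟩ := Nat.exists_eq_add_of_le' h
  rcases lt_or_ge n 6 with h' | h'
  · interval_cases n <;> decide
  · obtain ⟨i, rfl | rfl | rfl⟩ := exists_of_six_le h' <;> have := two_pow_le_three_pow i <;>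
      simp [add_assoc, conMax_add_mul] at * <;> omega

/-- The three branchings in this residue class: at a vertex of degree 3, and at a vertex of degree 2
whose neighbours have degrees 3, 3 or 3, 2. -/
theorem subcubic_le {n : ℕ} (h : 5 ≤ n) (h3 : n % 3 = 2) :
    conMax (n - 1) + conMax (n - 4) ≤ conMax n ∧
    conMax (n - 3) + 2 * moonMoser (n - 4) ≤ conMax n ∧
    2 * conMax (n - 3) + moonMoser (n - 4) ≤ conMax n := by
  obtain ⟨n, rfl⟩ := Nat.exists_eq_add_of_le' h
  rcases lt_or_ge n 6 with h' | h'
  · interval_cases n <;> revert h3 <;> decide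
  · obtain ⟨i, rfl | rfl | rfl⟩ := exists_of_six_le h' <;> have := two_pow_le_three_pow i <;>
      refine ⟨?_, ?_, ?_⟩ <;>
      simp [add_assoc, conMax_add_mul, moonMoser_add_mul, moonMoser] at * <;> omega

end Extremal

/-! ### Maximal independent sets, branching and the Moon–Moser bound. -/

namespace Extremal

open Classical

/-- The maximal independent sets of the subgraph of `G` induced on `A`. -/
noncomputable def maxIndep {V : Type*} (G : SimpleGraph V) (A : Finset V) : Finset (Finset V) :=
  A.powerset.filter fun S =>
    (∀ x ∈ S, ∀ y ∈ S, ¬ G.Adj x y) ∧ ∀ x ∈ A, x ∉ S → ∃ y ∈ S, G.Adj x y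

/-- The neighbours of `v` inside `A`. -/
noncomputable def nbrs {V : Type*} (G : SimpleGraph V) (A : Finset V) (v : V) : Finset V :=
  A.filter fun w => G.Adj v w

/-- The part of `A` outside the closed neighbourhood of `v`. -/
noncomputable def far {V : Type*} (G : SimpleGraph V) (A : Finset V) (v : V) : Finset V :=
  A.filter fun w => w ≠ v ∧ ¬ G.Adj v w

/-- `B` is a union of components of the subgraph induced on `A`. -/
def ClosedIn {V : Type*} (G : SimpleGraph V) (A B : Finset V) : Prop :=
  B ⊆ A ∧ ∀ x ∈ B, ∀ y ∈ A, G.Adj x y → y ∈ B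

/-- The subgraph induced on `A` is connected. -/
def Conn {V : Type*} (G : SimpleGraph V) (A : Finset V) : Prop :=
  A.Nonempty ∧ ∀ B, ClosedIn G A B → B.Nonempty → B = A

variable {V : Type*} {G : SimpleGraph V} {A B C S : Finset V} {v w : V}

theorem mem_maxIndep : S ∈ maxIndep G A ↔ S ⊆ A ∧ (∀ x ∈ S, ∀ y ∈ S, ¬ G.Adj x y) ∧
    ∀ x ∈ A, x ∉ S → ∃ y ∈ S, G.Adj x y := by
  simp [maxIndep]

theorem mem_nbrs : w ∈ nbrs G A v ↔ w ∈ A ∧ G.Adj v w := by simp [nbrs]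

theorem mem_far : w ∈ far G A v ↔ w ∈ A ∧ w ≠ v ∧ ¬ G.Adj v w := by simp [far]

theorem nbrs_subset : nbrs G A v ⊆ A := Finset.filter_subset _ _

theorem far_subset : far G A v ⊆ A := Finset.filter_subset _ _

theorem card_far_add (hv : v ∈ A) : (far G A v).card + (nbrs G A v).card + 1 = A.card := by
  have h1 : (far G A v ∪ nbrs G A v) = A.erase v := by
    ext w
    simp only [Finset.mem_union, mem_far, mem_nbrs, Finset.mem_erase]
    constructor
    · rintro (⟨h, h', -⟩ | ⟨h, h'⟩)
      · exact ⟨h', h⟩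
      · exact ⟨h'.ne', h⟩
    · rintro ⟨h, h'⟩
      by_cases h2 : G.Adj v w
      · exact .inr ⟨h', h2⟩
      · exact .inl ⟨h', h, h2⟩
  rw [← Finset.card_union_of_disjoint, h1, Finset.card_erase_add_one hv]
  rw [Finset.disjoint_left]
  intro w hw hw'
  exact (mem_far.1 hw).2.2 (mem_nbrs.1 hw').2

theorem far_eq : far G A v = A \ insert v (nbrs G A v) := by
  ext w
  simp only [mem_far, Finset.mem_sdiff, Finset.mem_insert, mem_nbrs]
  tauto

/-- Maximal independent sets through `v` correspond to those of the part far from `v`. -/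
theorem erase_mem_maxIndep_far (hS : S ∈ maxIndep G A) (hv : v ∈ S) :
    S.erase v ∈ maxIndep G (far G A v) := by
  rw [mem_maxIndep] at hS ⊢
  obtain ⟨h1, h2, h3⟩ := hS
  refine ⟨fun w hw => ?_, fun x hx y hy => h2 x (Finset.mem_of_mem_erase hx) y
    (Finset.mem_of_mem_erase hy), fun x hx hxS => ?_⟩
  · rw [Finset.mem_erase] at hw
    exact mem_far.2 ⟨h1 hw.2, hw.1, h2 v hv w hw.2⟩
  · rw [mem_far] at hx
    obtain ⟨y, hy, hxy⟩ := h3 x hx.1 fun h => hxS (Finset.mem_erase.2 ⟨hx.2.1, h⟩)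
    refine ⟨y, Finset.mem_erase.2 ⟨?_, hy⟩, hxy⟩
    rintro rfl
    exact hx.2.2 hxy.symm

theorem mem_maxIndep_erase (hS : S ∈ maxIndep G A) (hv : v ∉ S) :
    S ∈ maxIndep G (A.erase v) := by
  rw [mem_maxIndep] at hS ⊢
  obtain ⟨h1, h2, h3⟩ := hS
  exact ⟨fun w hw => Finset.mem_erase.2 ⟨fun h => hv (h ▸ hw), h1 hw⟩, h2,
    fun x hx => h3 x (Finset.mem_of_mem_erase hx)⟩

theorem card_filter_mem_le :
    ((maxIndep G A).filter (v ∈ ·)).card ≤ (maxIndep G (far G A v)).card := by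
  refine Finset.card_le_card_of_injOn (fun S => S.erase v) (fun S hS => ?_) ?_
  · rw [Finset.mem_coe, Finset.mem_filter] at hS
    exact erase_mem_maxIndep_far hS.1 hS.2
  · intro S hS T hT h
    rw [Finset.mem_coe, Finset.mem_filter] at hS hT
    rw [← Finset.insert_erase hS.2, ← Finset.insert_erase hT.2]
    exact congrArg _ h

/-- Branching on whether `v` belongs to the set. -/
theorem card_maxIndep_le_erase_add_far :
    (maxIndep G A).card ≤ (maxIndep G (A.erase v)).card + (maxIndep G (far G A v)).card := by
  rw [← Finset.card_filter_add_card_filter_not (s := maxIndep G A) (v ∈ ·), add_comm]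
  refine Nat.add_le_add (Finset.card_le_card fun S hS => ?_) card_filter_mem_le
  rw [Finset.mem_filter] at hS
  exact mem_maxIndep_erase hS.1 hS.2

/-- Branching on which element of the closed neighbourhood of `v` belongs to the set. -/
theorem card_maxIndep_le_sum (hv : v ∈ A) :
    (maxIndep G A).card ≤ ∑ w ∈ insert v (nbrs G A v), (maxIndep G (far G A w)).card := by
  have h : maxIndep G A ⊆
      (insert v (nbrs G A v)).biUnion fun w => (maxIndep G A).filter (w ∈ ·) := by
    intro S hS
    obtain ⟨h1, -, h3⟩ := mem_maxIndep.1 hS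
    rw [Finset.mem_biUnion]
    by_cases hvS : v ∈ S
    · exact ⟨v, Finset.mem_insert_self _ _, Finset.mem_filter.2 ⟨hS, hvS⟩⟩
    · obtain ⟨y, hy, hvy⟩ := h3 v hv hvS
      exact ⟨y, Finset.mem_insert_of_mem (mem_nbrs.2 ⟨h1 hy, hvy⟩), Finset.mem_filter.2 ⟨hS, hy⟩⟩
  exact (Finset.card_le_card h).trans
    (Finset.card_biUnion_le.trans (Finset.sum_le_sum fun w _ => card_filter_mem_le))

theorem inter_mem_maxIndep (hAB : ∀ x ∈ B, ∀ y ∈ A, G.Adj x y → y ∈ B) (hB : B ⊆ A)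
    (hS : S ∈ maxIndep G A) : S ∩ B ∈ maxIndep G B := by
  obtain ⟨h1, h2, h3⟩ := mem_maxIndep.1 hS
  refine mem_maxIndep.2 ⟨Finset.inter_subset_right, fun x hx y hy =>
    h2 x (Finset.mem_of_mem_inter_left hx) y (Finset.mem_of_mem_inter_left hy), fun x hx hxS => ?_⟩
  obtain ⟨y, hy, hxy⟩ := h3 x (hB hx) fun h => hxS (Finset.mem_inter.2 ⟨h, hx⟩)
  exact ⟨y, Finset.mem_inter.2 ⟨hy, hAB x hx y (h1 hy) hxy⟩, hxy⟩

/-- Disjoint parts without edges between them multiply. -/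
theorem card_maxIndep_union_le (hBC : ∀ x ∈ B, ∀ y ∈ C, ¬ G.Adj x y) :
    (maxIndep G (B ∪ C)).card ≤ (maxIndep G B).card * (maxIndep G C).card := by
  rw [← Finset.card_product]
  refine Finset.card_le_card_of_injOn (fun S => (S ∩ B, S ∩ C)) (fun S hS => ?_) ?_
  · rw [Finset.mem_coe] at hS
    refine Finset.mem_product.2 ⟨inter_mem_maxIndep (fun x hx y hy hxy => ?_)
      Finset.subset_union_left hS, inter_mem_maxIndep (fun x hx y hy hxy => ?_)
      Finset.subset_union_right hS⟩
    · exact (Finset.mem_union.1 hy).resolve_right fun h => hBC x hx y h hxy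
    · exact (Finset.mem_union.1 hy).resolve_left fun h => hBC y h x hx hxy.symm
  · intro S hS T hT h
    have e : ∀ S ∈ maxIndep G (B ∪ C), S = (S ∩ B) ∪ (S ∩ C) := fun S hS => by
      rw [← Finset.inter_union_distrib_left]
      exact (Finset.inter_eq_left.2 (mem_maxIndep.1 hS).1).symm
    simp only [Prod.mk.injEq] at h
    rw [e S hS, e T hT, h.1, h.2]

/-- A graph without edges has just one maximal independent set. -/
theorem card_maxIndep_of_edgeless (h : ∀ x ∈ A, ∀ y ∈ A, ¬ G.Adj x y) :
    (maxIndep G A).card ≤ 1 := by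
  refine Finset.card_le_one.2 fun S hS T hT => ?_
  have e : ∀ S ∈ maxIndep G A, S = A := fun S hS => by
    obtain ⟨h1, -, h3⟩ := mem_maxIndep.1 hS
    refine h1.antisymm fun x hx => ?_
    by_contra hxS
    obtain ⟨y, hy, hxy⟩ := h3 x hx hxS
    exact h x hx y (h1 hy) hxy
  rw [e S hS, e T hT]

/-- The Moon–Moser bound. -/
theorem card_maxIndep_le_moonMoser (G : SimpleGraph V) (A : Finset V) :
    (maxIndep G A).card ≤ moonMoser A.card := by
  induction hn : A.card using Nat.strong_induction_on generalizing A with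
  | _ n ih =>
    subst hn
    rcases A.eq_empty_or_nonempty with rfl | hA
    · exact card_maxIndep_of_edgeless (by simp)
    -- At a vertex of least degree `k`, each of the `k + 1` branches deletes at least `k + 1`
    -- vertices.
    obtain ⟨v, hv, hmin⟩ := Finset.exists_min_image A (fun v => (nbrs G A v).card) hA
    refine (card_maxIndep_le_sum hv).trans ?_
    set k := (nbrs G A v).card with hk
    have hcard : (insert v (nbrs G A v)).card = k + 1 := by
      rw [Finset.card_insert_of_notMem]
      simp [mem_nbrs]
    have hb : ∀ w ∈ insert v (nbrs G A v),
        (maxIndep G (far G A w)).card ≤ moonMoser (A.card - (k + 1)) := by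
      intro w hw
      have hwA : w ∈ A := by
        rcases Finset.mem_insert.1 hw with rfl | h
        · exact hv
        · exact nbrs_subset h
      have h1 := card_far_add (G := G) hwA
      have h2 := hmin w hwA
      exact (ih _ (by omega) (far G A w) rfl).trans (moonMoser_mono (by omega))
    refine (Finset.sum_le_card_nsmul _ _ _ hb).trans ?_
    rw [hcard, smul_eq_mul]
    have h1 := card_far_add (G := G) hv
    refine (mul_moonMoser_le (by omega)).trans (moonMoser_mono ?_)
    omega

theorem card_maxIndep_le_of_card_le {k : ℕ} (h : A.card ≤ k) :
    (maxIndep G A).card ≤ moonMoser k :=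
  (card_maxIndep_le_moonMoser G A).trans (moonMoser_mono h)

/-! ### Connectedness of vertex sets. -/

theorem ClosedIn.sdiff (h : ClosedIn G A B) : ClosedIn G A (A \ B) := by
  refine ⟨Finset.sdiff_subset, fun x hx y hy hxy => ?_⟩
  rw [Finset.mem_sdiff] at hx ⊢
  exact ⟨hy, fun hyB => hx.2 (h.2 y hyB x hx.1 hxy.symm)⟩

/-- A nonempty proper subset of a connected set has an edge leaving it. -/
theorem Conn.exists_adj (h : Conn G A) (hB : B ⊆ A) (hne : B.Nonempty) (hBA : B ≠ A) :
    ∃ x ∈ B, ∃ y ∈ A, y ∉ B ∧ G.Adj x y := by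
  by_contra hc
  push Not at hc
  exact hBA (h.2 B ⟨hB, fun x hx y hy hxy => by_contra fun hyB => hc x hx y hy hyB hxy⟩ hne)

theorem conn_singleton : Conn G {v} := by
  refine ⟨Finset.singleton_nonempty v, fun B hB hne => ?_⟩
  exact (Finset.Nonempty.subset_singleton_iff hne).1 hB.1

/-- A connected set stays connected when a vertex adjacent to it is added. -/
theorem Conn.insert (h : Conn G A) {x : V} (hx : x ∈ A) (hvx : G.Adj v x) :
    Conn G (insert v A) := by
  refine ⟨Finset.insert_nonempty _ _, fun B hB hne => ?_⟩
  have hc : ClosedIn G A (B ∩ A) :=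
    ⟨Finset.inter_subset_right, fun x hx y hy hxy => Finset.mem_inter.2
      ⟨hB.2 x (Finset.mem_of_mem_inter_left hx) y (Finset.mem_insert_of_mem hy) hxy, hy⟩⟩
  have hne' : (B ∩ A).Nonempty := by
    obtain ⟨y, hy⟩ := hne
    rcases Finset.mem_insert.1 (hB.1 hy) with rfl | h'
    · exact ⟨x, Finset.mem_inter.2 ⟨hB.2 y hy x (Finset.mem_insert_of_mem hx) hvx, hx⟩⟩
    · exact ⟨y, Finset.mem_inter.2 ⟨hy, h'⟩⟩
  have hAB : A ⊆ B := by
    rw [← h.2 _ hc hne']; exact Finset.inter_subset_left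
  refine hB.1.antisymm (Finset.insert_subset ?_ hAB)
  exact hB.2 x (hAB hx) v (Finset.mem_insert_self _ _) hvx.symm

/-- Connectedness may be tested at a base point. -/
theorem conn_of_base {p : V} (hp : p ∈ A) (h : ∀ B, ClosedIn G A B → p ∉ B → B = ∅) :
    Conn G A := by
  refine ⟨⟨p, hp⟩, fun B hB hne => ?_⟩
  have hpB : p ∈ B := by
    by_contra hp
    exact hne.ne_empty (h B hB hp)
  have := h _ hB.sdiff (fun h => (Finset.mem_sdiff.1 h).2 hpB)
  exact hB.1.antisymm (Finset.sdiff_eq_empty_iff_subset.1 this)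

/-- Deleting `U` keeps `A` connected if some `w ∈ U` can be deleted and all other edges between `U`
and the rest end in one vertex `p`. -/
theorem conn_sdiff {U : Finset V} {p : V} (hw : Conn G (A.erase w)) (hwU : w ∈ U) (hpA : p ∈ A)
    (hpU : p ∉ U) (h : ∀ u ∈ U, u ≠ w → ∀ y ∈ A, y ∉ U → G.Adj u y → y = p) :
    Conn G (A \ U) := by
  refine conn_of_base (Finset.mem_sdiff.2 ⟨hpA, hpU⟩) fun B hB hp => ?_
  by_contra hne
  have hBA : B ⊆ A.erase w := fun x hx => by
    have := Finset.mem_sdiff.1 (hB.1 hx)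
    exact Finset.mem_erase.2 ⟨fun h => this.2 (h ▸ hwU), this.1⟩
  have hpw : p ∈ A.erase w := Finset.mem_erase.2 ⟨fun h => hpU (h ▸ hwU), hpA⟩
  obtain ⟨x, hx, y, hy, hyB, hxy⟩ := hw.exists_adj hBA (Finset.nonempty_iff_ne_empty.2 hne)
    (fun h => hp (h ▸ hpw))
  rw [Finset.mem_erase] at hy
  have hxU := Finset.mem_sdiff.1 (hB.1 hx)
  by_cases hyU : y ∈ U
  · exact hp (h y hyU hy.1 x hxU.1 hxU.2 hxy.symm ▸ hx)
  · exact hyB (hB.2 x hx y (Finset.mem_sdiff.2 ⟨hy.2, hyU⟩) hxy)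

/-- If `w` can be deleted, no vertex set is attached through `w` only. -/
theorem eq_of_closed_erase (hw : Conn G (A.erase w)) (hB : B ⊆ A.erase w) (hne : B.Nonempty)
    (h : ∀ x ∈ B, ∀ y ∈ A, G.Adj x y → y = w ∨ y ∈ B) : B = A.erase w :=
  hw.2 B ⟨hB, fun x hx y hy hxy => (h x hx y (Finset.mem_of_mem_erase hy) hxy).resolve_left
    (Finset.ne_of_mem_erase hy)⟩ hne

end Extremal

/-! ### Branching at vertices that are not cut vertices. -/

namespace Extremal

open Classical

variable {V : Type*} {G : SimpleGraph V} {A X C : Finset V} {v a b p q : V}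

/-- The bound for connected graphs holds for all graphs with fewer than `n` vertices. -/
def BoundBelow (G : SimpleGraph V) (n : ℕ) : Prop :=
  ∀ B : Finset V, B.card < n → Conn G B → (maxIndep G B).card ≤ conMax B.card

theorem mem_of_mem_nbrs_eq {w : V} {N : Finset V} (h : nbrs G A v = N) (hw : w ∈ N) :
    w ∈ A ∧ G.Adj v w := mem_nbrs.1 (h ▸ hw)

theorem card_maxIndep_le_of_noncut (ih : BoundBelow G A.card) (hv : v ∈ A)
    (hc : Conn G (A.erase v)) :
    (maxIndep G A).card ≤ conMax (A.card - 1) + (maxIndep G (far G A v)).card := by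
  refine card_maxIndep_le_erase_add_far.trans (Nat.add_le_add_right ?_ _)
  have := ih (A.erase v) (Finset.card_erase_lt_of_mem hv) hc
  rwa [Finset.card_erase_of_mem hv] at this

/-- The only neighbour of a leaf would be a cut vertex. -/
theorem two_le_card_nbrs (hA : Conn G A) (hn : 3 ≤ A.card) (hv : v ∈ A)
    (h : ∀ p ∈ nbrs G A v, Conn G (A.erase p)) : 2 ≤ (nbrs G A v).card := by
  by_contra hlt
  rcases (by omega : (nbrs G A v).card = 0 ∨ (nbrs G A v).card = 1) with h0 | h1
  · obtain ⟨x, hx, y, hy, -, hxy⟩ := hA.exists_adj (Finset.singleton_subset_iff.2 hv)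
      (Finset.singleton_nonempty v) (fun e => by rw [← e, Finset.card_singleton] at hn; omega)
    rw [Finset.mem_singleton] at hx
    subst hx
    rw [Finset.card_eq_zero] at h0
    exact Finset.notMem_empty y (h0 ▸ mem_nbrs.2 ⟨hy, hxy⟩)
  · obtain ⟨p, hp⟩ := Finset.card_eq_one.1 h1
    have hpA := mem_of_mem_nbrs_eq hp (Finset.mem_singleton_self p)
    have := eq_of_closed_erase (h p (hp ▸ Finset.mem_singleton_self p)) (B := {v})
      (Finset.singleton_subset_iff.2 (Finset.mem_erase.2 ⟨hpA.2.ne, hv⟩))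
      (Finset.singleton_nonempty v) (fun x hx y hy hxy => by
        rw [Finset.mem_singleton] at hx
        subst hx
        have : y ∈ nbrs G A x := mem_nbrs.2 ⟨hy, hxy⟩
        rw [hp, Finset.mem_singleton] at this
        exact .inl this)
    have h2 := congrArg Finset.card this
    rw [Finset.card_singleton, Finset.card_erase_of_mem hpA.1] at h2
    omega

theorem card_maxIndep_le_of_nbrs_pair (hv : v ∈ A) (hN : nbrs G A v = {a, b}) (hab : a ≠ b) :
    (maxIndep G A).card ≤ (maxIndep G (far G A v)).card + (maxIndep G (far G A a)).card +
      (maxIndep G (far G A b)).card := by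
  have h := card_maxIndep_le_sum (G := G) hv
  have ha := (mem_of_mem_nbrs_eq hN (by simp : a ∈ ({a, b} : Finset V))).2.ne
  have hb := (mem_of_mem_nbrs_eq hN (by simp : b ∈ ({a, b} : Finset V))).2.ne
  rw [hN, Finset.sum_insert (by simp [ha, hb]), Finset.sum_pair hab, ← add_assoc] at h
  exact h

theorem card_maxIndep_le_of_leaf (hv : v ∈ A) (hN : nbrs G A v = {p}) :
    (maxIndep G A).card ≤ (maxIndep G (far G A v)).card + (maxIndep G (far G A p)).card := by
  have h := card_maxIndep_le_sum (G := G) hv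
  have hp := (mem_of_mem_nbrs_eq hN (Finset.mem_singleton_self p)).2.ne
  rwa [hN, Finset.sum_insert (by simp [hp]), Finset.sum_singleton] at h

/-- The outer neighbours of two adjacent vertices of degree two, and deleting the closed
neighbourhood of one of them. -/
theorem conn_far_of_nbrs_pair (hn : 4 ≤ A.card) (hv : v ∈ A) (hNv : nbrs G A v = {a, b})
    (hNa : nbrs G A a = {v, p}) (hab : a ≠ b) (hvp : v ≠ p)
    (hb : Conn G (A.erase b)) (hp : Conn G (A.erase p)) :
    p ≠ b ∧ Conn G (far G A a) := by
  have ha := mem_of_mem_nbrs_eq hNv (by simp : a ∈ ({a, b} : Finset V))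
  have hb' := mem_of_mem_nbrs_eq hNv (by simp : b ∈ ({a, b} : Finset V))
  have hp' := mem_of_mem_nbrs_eq hNa (by simp : p ∈ ({v, p} : Finset V))
  have adjv : ∀ y ∈ A, G.Adj v y → y = a ∨ y = b := fun y hy h => by
    have : y ∈ nbrs G A v := mem_nbrs.2 ⟨hy, h⟩
    simpa [hNv] using this
  have adja : ∀ y ∈ A, G.Adj a y → y = v ∨ y = p := fun y hy h => by
    have : y ∈ nbrs G A a := mem_nbrs.2 ⟨hy, h⟩
    simpa [hNa] using this
  have hpb : p ≠ b := by
    rintro rfl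
    have := eq_of_closed_erase hb (B := {v, a})
      (by
        intro x hx
        rw [Finset.mem_insert, Finset.mem_singleton] at hx
        rcases hx with rfl | rfl
        · exact Finset.mem_erase.2 ⟨hvp, hv⟩
        · exact Finset.mem_erase.2 ⟨hab, ha.1⟩)
      (Finset.insert_nonempty _ _) (by
        intro x hx y hy hxy
        rw [Finset.mem_insert, Finset.mem_singleton] at hx ⊢
        rcases hx with rfl | rfl
        · rcases adjv y hy hxy with h | h <;> simp [h]
        · rcases adja y hy hxy with h | h <;> simp [h])
    have h2 := congrArg Finset.card this
    rw [Finset.card_pair ha.2.ne, Finset.card_erase_of_mem hb'.1] at h2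
    omega
  refine ⟨hpb, ?_⟩
  rw [far_eq, hNa]
  -- Of the deleted vertices `a`, `v`, `p`, the last is not a cut vertex, and the other two reach
  -- the rest only at `b`.
  refine conn_sdiff hp (by simp) hb'.1 (by simp [hab.symm, hpb.symm, hb'.2.ne']) ?_
  intro u hu hup y hy hyU hadj
  simp only [Finset.mem_insert, Finset.mem_singleton] at hu hyU
  rcases hu with rfl | rfl | rfl
  · rcases adja y hy hadj with h | h <;> simp [h] at hyU
  · rcases adjv y hy hadj with h | h
    · simp [h] at hyU
    · exact h
  · exact absurd rfl hup

/-- Three consecutive vertices of degree two. -/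
theorem card_maxIndep_le_of_chain (ih : BoundBelow G A.card) (hn : 5 ≤ A.card) (hv : v ∈ A)
    (hNv : nbrs G A v = {a, b}) (hNa : nbrs G A a = {v, p}) (hNb : nbrs G A b = {v, q})
    (hab : a ≠ b) (hvp : v ≠ p) (hvq : v ≠ q) (ha : Conn G (A.erase a))
    (hb : Conn G (A.erase b)) (hp : Conn G (A.erase p)) (hq : Conn G (A.erase q)) :
    (maxIndep G A).card ≤ conMax A.card := by
  obtain ⟨hpb, hfa⟩ := conn_far_of_nbrs_pair (by omega) hv hNv hNa hab hvp hb hp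
  obtain ⟨hqa, -⟩ := conn_far_of_nbrs_pair (by omega) hv (hNv.trans (Finset.pair_comm a b)) hNb
    hab.symm hvq ha hq
  have ha' := mem_of_mem_nbrs_eq hNv (by simp : a ∈ ({a, b} : Finset V))
  have hb' := mem_of_mem_nbrs_eq hNv (by simp : b ∈ ({a, b} : Finset V))
  have hp' := mem_of_mem_nbrs_eq hNa (by simp : p ∈ ({v, p} : Finset V))
  have hq' := mem_of_mem_nbrs_eq hNb (by simp : q ∈ ({v, q} : Finset V))
  have adjv : ∀ y ∈ A, G.Adj v y → y = a ∨ y = b := fun y hy h => by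
    have : y ∈ nbrs G A v := mem_nbrs.2 ⟨hy, h⟩
    simpa [hNv] using this
  have adja : ∀ y ∈ A, G.Adj a y → y = v ∨ y = p := fun y hy h => by
    have : y ∈ nbrs G A a := mem_nbrs.2 ⟨hy, h⟩
    simpa [hNa] using this
  have adjb : ∀ y ∈ A, G.Adj b y → y = v ∨ y = q := fun y hy h => by
    have : y ∈ nbrs G A b := mem_nbrs.2 ⟨hy, h⟩
    simpa [hNb] using this
  -- Otherwise the path on `a`, `v`, `b` would hang at the single vertex `p`, making it a cut
  -- vertex.
  have hpq : p ≠ q := by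
    rintro rfl
    have := eq_of_closed_erase hp (B := {v, a, b})
      (by
        intro x hx
        simp only [Finset.mem_insert, Finset.mem_singleton] at hx
        rcases hx with rfl | rfl | rfl
        · exact Finset.mem_erase.2 ⟨hvp, hv⟩
        · exact Finset.mem_erase.2 ⟨hp'.2.ne, ha'.1⟩
        · exact Finset.mem_erase.2 ⟨hpb.symm, hb'.1⟩)
      (Finset.insert_nonempty _ _) (by
        intro x hx y hy hxy
        simp only [Finset.mem_insert, Finset.mem_singleton] at hx ⊢
        rcases hx with rfl | rfl | rfl
        · rcases adjv y hy hxy with h | h <;> simp [h]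
        · rcases adja y hy hxy with h | h <;> simp [h]
        · rcases adjb y hy hxy with h | h <;> simp [h])
    have h2 := congrArg Finset.card this
    have h3 := Finset.card_le_three (a := v) (b := a) (c := b)
    rw [Finset.card_erase_of_mem hp'.1] at h2
    omega
  have hva : v ∈ A.erase a := Finset.mem_erase.2 ⟨ha'.2.ne, hv⟩
  have hN : nbrs G (A.erase a) v = {b} := by
    ext y
    simp only [mem_nbrs, Finset.mem_erase, Finset.mem_singleton]
    constructor
    · rintro ⟨⟨h1, h2⟩, h3⟩
      exact (adjv y h2 h3).resolve_left h1
    · rintro rfl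
      exact ⟨⟨hab.symm, hb'.1⟩, hb'.2⟩
  have e1 : far G (A.erase a) v = A \ {a, v, b} := by
    rw [far_eq, hN]
    ext y
    simp only [Finset.mem_sdiff, Finset.mem_erase, Finset.mem_insert, Finset.mem_singleton]
    tauto
  have e2 : far G (A.erase a) b = A \ {a, v, b, q} := by
    have : nbrs G (A.erase a) b = {v, q} := by
      ext y
      simp only [mem_nbrs, Finset.mem_erase, Finset.mem_singleton, Finset.mem_insert]
      constructor
      · rintro ⟨⟨h1, h2⟩, h3⟩
        exact adjb y h2 h3
      · rintro (rfl | rfl)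
        · exact ⟨⟨ha'.2.ne, hv⟩, hb'.2.symm⟩
        · exact ⟨⟨hqa, hq'.1⟩, hq'.2⟩
    rw [far_eq, this]
    ext y
    simp only [Finset.mem_sdiff, Finset.mem_erase, Finset.mem_insert, Finset.mem_singleton]
    tauto
  have c1 : (A \ {a, v, b}).card = A.card - 3 := by
    rw [Finset.card_sdiff_of_subset (by
      intro x hx
      simp only [Finset.mem_insert, Finset.mem_singleton] at hx
      rcases hx with rfl | rfl | rfl <;> [exact ha'.1; exact hv; exact hb'.1])]
    rw [Finset.card_eq_three.2 ⟨a, v, b, ha'.2.ne', hab, hb'.2.ne, rfl⟩]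
  have c2 : (A \ {a, v, b, q}).card = A.card - 4 := by
    rw [Finset.card_sdiff_of_subset (by
      intro x hx
      simp only [Finset.mem_insert, Finset.mem_singleton] at hx
      rcases hx with rfl | rfl | rfl | rfl <;> [exact ha'.1; exact hv; exact hb'.1; exact hq'.1])]
    rw [Finset.card_insert_of_notMem (by simp [ha'.2.ne', hab, hqa.symm]),
      Finset.card_eq_three.2 ⟨v, b, q, hb'.2.ne, hvq, hq'.2.ne, rfl⟩]
  have k1 : Conn G (A \ {a, v, b}) := by
    refine conn_sdiff hb (by simp) hp'.1 (by simp [hp'.2.ne', hvp.symm, hpb]) ?_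
    intro u hu hub y hy hyU hadj
    simp only [Finset.mem_insert, Finset.mem_singleton] at hu hyU
    rcases hu with rfl | rfl | rfl
    · rcases adja y hy hadj with h | h
      · simp [h] at hyU
      · exact h
    · rcases adjv y hy hadj with h | h <;> simp [h] at hyU
    · exact absurd rfl hub
  have k2 : Conn G (A \ {a, v, b, q}) := by
    refine conn_sdiff hq (by simp) hp'.1 (by simp [hp'.2.ne', hvp.symm, hpb, hpq]) ?_
    intro u hu hub y hy hyU hadj
    simp only [Finset.mem_insert, Finset.mem_singleton] at hu hyU
    rcases hu with rfl | rfl | rfl | rfl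
    · rcases adja y hy hadj with h | h
      · simp [h] at hyU
      · exact h
    · rcases adjv y hy hadj with h | h <;> simp [h] at hyU
    · rcases adjb y hy hadj with h | h <;> simp [h] at hyU
    · exact absurd rfl hub
  have c3 : (far G A a).card = A.card - 3 := by
    have := card_far_add (G := G) ha'.1
    rw [hNa, Finset.card_pair hvp] at this
    omega
  -- Branch on `a`; once `a` is deleted, `v` is a leaf at `b`, so branch on `v` or `b`. The three
  -- remaining graphs are connected, of sizes `n - 3`, `n - 3` and `n - 4`.
  have m1 := card_maxIndep_le_erase_add_far (G := G) (A := A) (v := a)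
  have m2 := card_maxIndep_le_of_leaf hva hN
  have i1 := ih _ (by omega) hfa
  have i2 := ih _ (by omega) k1
  have i3 := ih _ (by omega) k2
  rw [e1, e2] at m2
  rw [c3] at i1
  rw [c1] at i2
  rw [c2] at i3
  have := chain_le hn
  omega

/-- If a connected `C` avoiding `N[v]` is as large as possible, then the rest outside `N[v]` has
no edges. -/
theorem card_maxIndep_far_le_of_maximal (ih : BoundBelow G A.card) (hA : Conn G A)
    (hXA : X ⊆ A) (h3 : ∀ w ∈ X, (nbrs G A w).card ≤ 3) (hv : v ∈ X) (hC : Conn G C)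
    (hCv : C ⊆ far G A v) (hXC : A \ X ⊆ C)
    (hmax : ∀ w ∈ X, ∀ D, Conn G D → D ⊆ far G A w → A \ X ⊆ D → D.card ≤ C.card) :
    (maxIndep G (far G A v)).card ≤ conMax (far G A v).card := by
  have hD : ∀ u ∈ far G A v, u ∉ C → ∀ x ∈ C, ¬ G.Adj u x := by
    intro u hu huC x hx hux
    have := hmax v hv (insert u C) (hC.insert hx hux) (Finset.insert_subset hu hCv)
      (hXC.trans (Finset.subset_insert _ _))
    rw [Finset.card_insert_of_notMem huC] at this
    omega
  obtain ⟨x, hx, a, ha, haC, hxa⟩ := hA.exists_adj (hCv.trans far_subset) hC.1 (fun e => by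
    have := mem_far.1 (hCv (e ▸ hXA hv))
    exact this.2.1 rfl)
  have hav : G.Adj v a := by
    by_contra hva
    by_cases e : a = v
    · subst e
      exact (mem_far.1 (hCv hx)).2.2 hxa.symm
    · exact hD a (mem_far.2 ⟨ha, e, hva⟩) haC x hx hxa.symm
  have haX : a ∈ X := by
    by_contra h
    exact haC (hXC (Finset.mem_sdiff.2 ⟨ha, h⟩))
  -- If `u` missed `a`, then `C` enlarged by `a` would be a larger connected set avoiding the closed
  -- neighbourhood of `u`.
  have hDa : ∀ u ∈ far G A v, u ∉ C → G.Adj u a := by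
    intro u hu huC
    by_contra hua
    have huA := mem_far.1 hu
    have huX : u ∈ X := by
      by_contra h
      exact huC (hXC (Finset.mem_sdiff.2 ⟨huA.1, h⟩))
    have := hmax u huX (insert a C) (hC.insert hx hxa.symm) (Finset.insert_subset
      (mem_far.2 ⟨ha, fun e => huA.2.2 (e ▸ hav), hua⟩) (fun y hy => mem_far.2
        ⟨far_subset (hCv hy), fun e => huC (e ▸ hy), hD u hu huC y hy⟩))
      (hXC.trans (Finset.subset_insert _ _))
    rw [Finset.card_insert_of_notMem haC] at this
    omega
  -- Two such vertices, together with `v` and `x`, would give `a` degree at least 4.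
  have hedge : ∀ u ∈ far G A v \ C, ∀ w ∈ far G A v \ C, ¬ G.Adj u w := by
    intro u hu w hw huw
    rw [Finset.mem_sdiff] at hu hw
    have hvu := (mem_far.1 hu.1).2.1
    have hvw := (mem_far.1 hw.1).2.1
    have hvx := (mem_far.1 (hCv hx)).2.1
    have hsub : ({v, x, u, w} : Finset V) ⊆ nbrs G A a := by
      intro y hy
      simp only [Finset.mem_insert, Finset.mem_singleton] at hy
      rcases hy with rfl | rfl | rfl | rfl
      · exact mem_nbrs.2 ⟨hXA hv, hav.symm⟩
      · exact mem_nbrs.2 ⟨far_subset (hCv hx), hxa.symm⟩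
      · exact mem_nbrs.2 ⟨far_subset hu.1, (hDa _ hu.1 hu.2).symm⟩
      · exact mem_nbrs.2 ⟨far_subset hw.1, (hDa _ hw.1 hw.2).symm⟩
    have h1 := Finset.card_le_card hsub
    rw [Finset.card_insert_of_notMem (by simp [hvu.symm, hvw.symm, hvx.symm]),
      Finset.card_eq_three.2 ⟨x, u, w, fun e => hu.2 (e ▸ hx), fun e => hw.2 (e ▸ hx), huw.ne,
        rfl⟩] at h1
    have h2 := h3 a haX
    omega
  have e : far G A v = (far G A v \ C) ∪ C := (Finset.sdiff_union_of_subset hCv).symm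
  rw [e]
  refine (card_maxIndep_union_le fun u hu x hx => ?_).trans ?_
  · rw [Finset.mem_sdiff] at hu
    exact hD u hu.1 hu.2 x hx
  rw [← e]
  have h1 := card_maxIndep_of_edgeless hedge
  have hlt : (far G A v).card < A.card := by
    have := card_far_add (G := G) (hXA hv)
    omega
  have h2 := ih C ((Finset.card_le_card hCv).trans_lt hlt) hC
  have h4 := conMax_mono (Finset.card_le_card hCv)
  calc _ ≤ 1 * conMax C.card := Nat.mul_le_mul h1 h2
    _ ≤ _ := by rw [one_mul]; exact h4

/-- The bound when there is a set `X` of vertices none of which is a cut vertex, such that a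
vertex of `X` misses a connected set containing the complement of `X`. -/
theorem card_maxIndep_le_of_inner (ih : BoundBelow G A.card) (hA : Conn G A) (hn : 5 ≤ A.card)
    (hXA : X ⊆ A) (hX : ∀ w ∈ X, Conn G (A.erase w))
    (h2 : ∀ w ∈ X, (nbrs G A w).card ≤ 2 → nbrs G A w ⊆ X) (hv : v ∈ X) (hC : Conn G C)
    (hCv : C ⊆ far G A v) (hXC : A \ X ⊆ C) :
    (maxIndep G A).card ≤ conMax A.card := by
  by_cases h4 : ∃ w ∈ X, 4 ≤ (nbrs G A w).card
  · obtain ⟨w, hw, h4⟩ := h4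
    refine (card_maxIndep_le_of_noncut ih (hXA hw) (hX w hw)).trans
      (le_trans (Nat.add_le_add_left ?_ _) (noncut_four_le hn))
    refine card_maxIndep_le_of_card_le ?_
    have := card_far_add (G := G) (hXA hw)
    omega
  push Not at h4
  by_cases h3 : A.card % 3 ≠ 2 ∧ ∃ w ∈ X, 3 ≤ (nbrs G A w).card
  · obtain ⟨hmod, w, hw, h3⟩ := h3
    refine (card_maxIndep_le_of_noncut ih (hXA hw) (hX w hw)).trans
      (le_trans (Nat.add_le_add_left ?_ _) (noncut_three_le hn hmod))
    refine card_maxIndep_le_of_card_le ?_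
    have := card_far_add (G := G) (hXA hw)
    omega
  have hmod : ∀ w ∈ X, 3 ≤ (nbrs G A w).card → A.card % 3 = 2 := fun w hw h => by
    by_contra hne
    exact h3 ⟨hne, w, hw, h⟩
  clear h3
  have hdeg : ∀ w ∈ X, (nbrs G A w).card = 3 ∨ (nbrs G A w).card = 2 ∧ nbrs G A w ⊆ X := by
    intro w hw
    by_cases h : 3 ≤ (nbrs G A w).card
    · exact .inl (by have := h4 w hw; omega)
    · have hsub := h2 w hw (by omega)
      have := two_le_card_nbrs hA (by omega) (hXA hw) fun p hp => hX p (hsub hp)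
      exact .inr ⟨by omega, hsub⟩
  -- All degrees in `X` are now 2 or 3. Maximality over all pairs, not just for one vertex, is what
  -- `card_maxIndep_far_le_of_maximal` needs.
  obtain ⟨⟨v, C⟩, hmem, hmax⟩ := Finset.exists_max_image
    ((X ×ˢ A.powerset).filter fun z => Conn G z.2 ∧ z.2 ⊆ far G A z.1 ∧ A \ X ⊆ z.2)
    (fun z => z.2.card) ⟨(v, C), Finset.mem_filter.2 ⟨Finset.mem_product.2
      ⟨hv, Finset.mem_powerset.2 (hCv.trans far_subset)⟩, hC, hCv, hXC⟩⟩
  simp only [Finset.mem_filter, Finset.mem_product, Finset.mem_powerset] at hmem hmax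
  obtain ⟨⟨hv, -⟩, hC, hCv, hXC⟩ := hmem
  have hfv := card_maxIndep_far_le_of_maximal ih hA hXA
    (fun w hw => by have := h4 w hw; omega) hv hC hCv hXC
    (fun w hw D hD hDw hXD => hmax (w, D) ⟨⟨hw, hDw.trans far_subset⟩, hD, hDw, hXD⟩)
  have hcv := card_far_add (G := G) (hXA hv)
  rcases hdeg v hv with hd | ⟨hd, hsub⟩
  · rw [show (far G A v).card = A.card - 4 by omega] at hfv
    have := (subcubic_le hn (hmod v hv hd.ge)).1
    have := card_maxIndep_le_of_noncut ih (hXA hv) (hX v hv)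
    omega
  obtain ⟨a, b, hab, hN⟩ := Finset.card_eq_two.1 hd
  have hsum := card_maxIndep_le_of_nbrs_pair (hXA hv) hN hab
  rw [show (far G A v).card = A.card - 3 by omega] at hfv
  have haX : a ∈ X := hsub (by simp [hN])
  have hbX : b ∈ X := hsub (by simp [hN])
  have hca := card_far_add (G := G) (hXA haX)
  have hcb := card_far_add (G := G) (hXA hbX)
  have hfa := card_maxIndep_le_moonMoser G (far G A a)
  have hfb := card_maxIndep_le_moonMoser G (far G A b)
  have hva := (mem_of_mem_nbrs_eq hN (by simp : a ∈ ({a, b} : Finset V))).2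
  have hvb := (mem_of_mem_nbrs_eq hN (by simp : b ∈ ({a, b} : Finset V))).2
  have outer : ∀ {w : V}, G.Adj v w → (nbrs G A w).card = 2 →
      ∃ p, v ≠ p ∧ nbrs G A w = {v, p} := by
    intro w hvw h
    obtain ⟨x, y, hxy, hw⟩ := Finset.card_eq_two.1 h
    have : v ∈ nbrs G A w := mem_nbrs.2 ⟨hXA hv, hvw.symm⟩
    rw [hw, Finset.mem_insert, Finset.mem_singleton] at this
    rcases this with rfl | rfl
    · exact ⟨y, hxy, hw⟩
    · exact ⟨x, hxy.symm, hw.trans (Finset.pair_comm _ _)⟩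
  rcases hdeg a haX with hda | ⟨hda, hsa⟩
  · obtain ⟨-, s1, s2⟩ := subcubic_le hn (hmod a haX hda.ge)
    rw [show (far G A a).card = A.card - 4 by omega] at hfa
    rcases hdeg b hbX with hdb | ⟨hdb, hsb⟩
    · rw [show (far G A b).card = A.card - 4 by omega] at hfb
      omega
    · obtain ⟨q, hvq, hNb⟩ := outer hvb hdb
      have hconn := (conn_far_of_nbrs_pair (by omega) (hXA hv) (hN.trans (Finset.pair_comm _ _))
        hNb hab.symm hvq (hX a haX) (hX q (hsb (by simp [hNb])))).2
      have := ih _ (by omega) hconn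
      rw [show (far G A b).card = A.card - 3 by omega] at this
      omega
  · obtain ⟨p, hvp, hNa⟩ := outer hva hda
    have hpX : p ∈ X := hsa (by simp [hNa])
    rcases hdeg b hbX with hdb | ⟨hdb, hsb⟩
    · obtain ⟨-, s1, s2⟩ := subcubic_le hn (hmod b hbX hdb.ge)
      rw [show (far G A b).card = A.card - 4 by omega] at hfb
      have hconn := (conn_far_of_nbrs_pair (by omega) (hXA hv) hN hNa hab hvp (hX b hbX)
        (hX p hpX)).2
      have := ih _ (by omega) hconn
      rw [show (far G A a).card = A.card - 3 by omega] at this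
      omega
    · obtain ⟨q, hvq, hNb⟩ := outer hvb hdb
      exact card_maxIndep_le_of_chain ih hn (hXA hv) hN hNa hNb hab hvp hvq (hX a haX)
        (hX b hbX) (hX p hpX) (hX q (hsb (by simp [hNb])))

end Extremal

/-! ### Graphs with a cut vertex, and the bound for connected graphs. -/

namespace Extremal

open Classical

variable {V : Type*} {G : SimpleGraph V} {A X Y : Finset V} {b v p q : V}

theorem card_far_add_of_notMem (hb : b ∉ X) : (far G X b).card + (nbrs G X b).card = X.card := by
  rw [← Finset.card_filter_add_card_filter_not (s := X) (fun w => G.Adj b w), add_comm]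
  refine congrArg₂ _ rfl (congrArg _ (Finset.filter_congr fun w hw => ?_))
  exact ⟨fun h => h.2, fun h => ⟨fun e => hb (e ▸ hw), h⟩⟩

theorem far_union : far G (X ∪ Y) b = far G X b ∪ far G Y b := Finset.filter_union _ _ _

/-- A nonempty union of components contains a component. -/
theorem exists_conn_subset (hY : ClosedIn G A Y) (hne : Y.Nonempty) :
    ∃ Z ⊆ Y, ClosedIn G A Z ∧ Conn G Z := by
  obtain ⟨Z, hZ, hmin⟩ := Finset.exists_min_image
    (Y.powerset.filter fun Z => ClosedIn G A Z ∧ Z.Nonempty) Finset.card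
    ⟨Y, by simp [hY, hne]⟩
  simp only [Finset.mem_filter, Finset.mem_powerset] at hZ hmin
  refine ⟨Z, hZ.1, hZ.2.1, hZ.2.2, fun B hB hBne => ?_⟩
  exact Finset.eq_of_subset_of_card_le hB.1 (hmin B ⟨hB.1.trans hZ.1, ⟨hB.1.trans hZ.2.1.1,
    fun x hx y hy hxy => hB.2 x hx y (hZ.2.1.2 x (hB.1 hx) y hy hxy) hxy⟩, hBne⟩)

/-- The counts for a union `Y` of components of `A - b`, combined with a small clique at `b`. -/
theorem attached_le (ih : BoundBelow G A.card) (hA : Conn G A) (hb : b ∈ A)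
    (hY : ClosedIn G (A.erase b) Y) {a : ℕ} (ha : 1 ≤ a) (ha3 : a ≤ 3) :
    a * (maxIndep G Y).card + (maxIndep G (far G Y b)).card ≤ conMax (Y.card + a + 1) := by
  induction hk : Y.card using Nat.strong_induction_on generalizing Y with
  | _ k ihk =>
    subst hk
    rcases Y.eq_empty_or_nonempty with rfl | hne
    · have h1 := card_maxIndep_of_edgeless (G := G) (A := ∅) (by simp)
      have h2 := card_maxIndep_of_edgeless (G := G) (A := far G ∅ b)
        (fun x hx => absurd (far_subset hx) (Finset.notMem_empty x))
      have h3 : a + 1 = conMax (0 + a + 1) := by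
        interval_cases a <;> rfl
      have h4 := Nat.mul_le_mul_left a h1
      rw [Finset.card_empty]
      omega
    -- One component `Z` is split off. It has a neighbour of `b`, so its part far from `b` loses a
    -- vertex.
    obtain ⟨Z, hZY, hZ, hZc⟩ := exists_conn_subset hY hne
    have hW : ClosedIn G (A.erase b) (Y \ Z) :=
      ⟨Finset.sdiff_subset.trans hY.1, fun x hx y hy hxy => by
        rw [Finset.mem_sdiff] at hx ⊢
        exact ⟨hY.2 x hx.1 y hy hxy, fun h => hx.2 (hZ.2 y h x (hY.1 hx.1) hxy.symm)⟩⟩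
    have hcard := Finset.card_sdiff_add_card_eq_card hZY
    have hZ0 := hZc.1.card_pos
    have hnoedge : ∀ x ∈ Y \ Z, ∀ y ∈ Z, ¬ G.Adj x y := fun x hx y hy hxy =>
      (Finset.mem_sdiff.1 hx).2 (hZ.2 y hy x (hW.1 hx) hxy.symm)
    have e : Y = (Y \ Z) ∪ Z := (Finset.sdiff_union_of_subset hZY).symm
    have m1 := card_maxIndep_union_le hnoedge
    have m2 := card_maxIndep_union_le (G := G) (B := far G (Y \ Z) b) (C := far G Z b)
      fun x hx y hy => hnoedge x (far_subset hx) y (far_subset hy)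
    rw [← far_union, ← e] at m2
    rw [← e] at m1
    have hbZ : b ∉ Z := fun h => (Finset.mem_erase.1 (hZ.1 h)).1 rfl
    have hq : (maxIndep G (far G Z b)).card ≤ moonMoser (Z.card - 1) := by
      refine card_maxIndep_le_of_card_le ?_
      obtain ⟨x, hx, y, hy, hyZ, hxy⟩ := hA.exists_adj (hZ.1.trans (Finset.erase_subset _ _)) hZc.1
        (fun h => hbZ (h ▸ hb))
      have hyb : y = b := by
        by_contra h
        exact hyZ (hZ.2 x hx y (Finset.mem_erase.2 ⟨h, hy⟩) hxy)
      subst hyb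
      have h1 := card_far_add_of_notMem (G := G) hbZ
      have h2 : 0 < (nbrs G Z y).card := Finset.card_pos.2 ⟨x, mem_nbrs.2 ⟨hx, hxy.symm⟩⟩
      omega
    have hlt : Z.card < A.card := by
      have := Finset.card_le_card hZ.1
      rw [Finset.card_erase_of_mem hb] at this
      have := Finset.card_pos.2 ⟨b, hb⟩
      omega
    have step := attach_step ha hZ0 (card_maxIndep_le_moonMoser G (Y \ Z))
      (ihk _ (by omega) hW rfl) (ih Z hlt hZc) hq
    rw [hcard] at step
    exact (Nat.add_le_add (Nat.mul_le_mul_left a m1) m2).trans step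

/-- A leaf of a connected set with at least three vertices. -/
theorem card_maxIndep_le_of_card_nbrs_le_one (hX : Conn G X) (h3 : 3 ≤ X.card) (hp : p ∈ X)
    (h1 : (nbrs G X p).card ≤ 1) :
    (maxIndep G X).card ≤ moonMoser (X.card - 2) + moonMoser (X.card - 3) := by
  obtain ⟨x, hx, q, hq, -, hpq⟩ := hX.exists_adj (Finset.singleton_subset_iff.2 hp)
    (Finset.singleton_nonempty p) (fun e => by rw [← e, Finset.card_singleton] at h3; omega)
  rw [Finset.mem_singleton] at hx
  subst hx
  have hN : nbrs G X x = {q} := (Finset.eq_of_subset_of_card_le (Finset.singleton_subset_iff.2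
    (mem_nbrs.2 ⟨hq, hpq⟩)) (by rwa [Finset.card_singleton])).symm
  have hsub : ({x, q} : Finset V) ⊆ X := by
    intro y hy
    rw [Finset.mem_insert, Finset.mem_singleton] at hy
    rcases hy with rfl | rfl <;> assumption
  obtain ⟨u, hu, w, hw, hwn, huw⟩ := hX.exists_adj hsub (Finset.insert_nonempty _ _)
    (fun e => by rw [← e, Finset.card_pair hpq.ne] at h3; omega)
  rw [Finset.mem_insert, Finset.mem_singleton] at hu hwn
  push Not at hwn
  have huq : u = q := by
    rcases hu with rfl | rfl
    · have : w ∈ nbrs G X u := mem_nbrs.2 ⟨hw, huw⟩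
      rw [hN, Finset.mem_singleton] at this
      exact absurd this hwn.2
    · rfl
  subst huq
  have h2 : 2 ≤ (nbrs G X u).card := by
    rw [← Finset.card_pair hwn.1.symm]
    refine Finset.card_le_card fun y hy => ?_
    rw [Finset.mem_insert, Finset.mem_singleton] at hy
    rcases hy with rfl | rfl
    · exact mem_nbrs.2 ⟨hp, hpq.symm⟩
    · exact mem_nbrs.2 ⟨hw, huw⟩
  have c1 := card_far_add (G := G) hp
  have c2 := card_far_add (G := G) hq
  rw [hN, Finset.card_singleton] at c1
  refine (card_maxIndep_le_of_leaf hp hN).trans (Nat.add_le_add ?_ ?_)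
  · exact card_maxIndep_le_of_card_le (by omega)
  · exact card_maxIndep_le_of_card_le (by omega)

/-- `X` is a union of some, but not all, components of `A - b`. -/
def Cuts (G : SimpleGraph V) (A : Finset V) (b : V) (X : Finset V) : Prop :=
  b ∈ A ∧ ClosedIn G (A.erase b) X ∧ X.Nonempty ∧ X ≠ A.erase b

theorem Cuts.notMem (hcut : Cuts G A b X) : b ∉ X :=
  fun h => (Finset.mem_erase.1 (hcut.2.1.1 h)).1 rfl

theorem Cuts.compl (hcut : Cuts G A b X) : Cuts G A b (A.erase b \ X) := by
  refine ⟨hcut.1, hcut.2.1.sdiff, ?_, fun e => ?_⟩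
  · rw [Finset.sdiff_nonempty]
    exact fun h => hcut.2.2.2 (hcut.2.1.1.antisymm h)
  · obtain ⟨x, hx⟩ := hcut.2.2.1
    exact (Finset.mem_sdiff.1 (e ▸ hcut.2.1.1 hx)).2 hx

/-- An edge leaving a subset of a union of components of `A - b` ends in `b` or in that union. -/
theorem Cuts.exists_adj_base (hcut : Cuts G A b X) (hA : Conn G A) {Z : Finset V} (hZX : Z ⊆ X)
    (hne : Z.Nonempty) : ∃ x ∈ Z, ∃ y ∈ A, y ∉ Z ∧ G.Adj x y ∧ (y = b ∨ y ∈ X) := by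
  obtain ⟨x, hx, y, hy, hyZ, hxy⟩ := hA.exists_adj
    (hZX.trans (hcut.2.1.1.trans (Finset.erase_subset _ _))) hne
    (fun e => hcut.notMem (hZX (e ▸ hcut.1)))
  refine ⟨x, hx, y, hy, hyZ, hxy, ?_⟩
  by_cases h : y = b
  · exact .inl h
  · exact .inr (hcut.2.1.2 x (hZX hx) y (Finset.mem_erase.2 ⟨h, hy⟩) hxy)

/-- Every component of `A - b` is joined to `b`, so the ones that stay hold together through `b`. -/
theorem Cuts.conn_sdiff (hcut : Cuts G A b X) (hA : Conn G A) : Conn G (A \ X) := by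
  refine conn_of_base (Finset.mem_sdiff.2 ⟨hcut.1, hcut.notMem⟩) fun B hB hbB => ?_
  by_contra hne
  have hBY : B ⊆ A.erase b \ X := fun x hx => by
    have := Finset.mem_sdiff.1 (hB.1 hx)
    exact Finset.mem_sdiff.2 ⟨Finset.mem_erase.2 ⟨fun e => hbB (e ▸ hx), this.1⟩, this.2⟩
  obtain ⟨x, hx, y, hy, hyB, hxy, h⟩ := hcut.compl.exists_adj_base hA hBY
    (Finset.nonempty_iff_ne_empty.2 hne)
  refine hyB (hB.2 x hx y (Finset.mem_sdiff.2 ⟨hy, ?_⟩) hxy)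
  rcases h with rfl | h
  · exact hcut.notMem
  · exact (Finset.mem_sdiff.1 h).2

theorem Cuts.conn_of_minimal (hcut : Cuts G A b X)
    (hmin : ∀ c Z, Cuts G A c Z → X.card ≤ Z.card) : Conn G X := by
  refine ⟨hcut.2.2.1, fun B hB hne => ?_⟩
  refine Finset.eq_of_subset_of_card_le hB.1 (hmin b B ⟨hcut.1, ⟨hB.1.trans hcut.2.1.1, ?_⟩, hne,
    fun e => hcut.2.2.2 (hcut.2.1.1.antisymm (e ▸ hB.1))⟩)
  exact fun x hx y hy hxy => hB.2 x hx y (hcut.2.1.2 x (hB.1 hx) y hy hxy) hxy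

/-- If `w` were a cut vertex, the components of `A - w` without `b` would lie inside `X` and miss
`w`, a smaller choice. -/
theorem Cuts.conn_erase_of_minimal (hcut : Cuts G A b X) (hA : Conn G A)
    (hmin : ∀ c Z, Cuts G A c Z → X.card ≤ Z.card) {w : V} (hw : w ∈ X) :
    Conn G (A.erase w) := by
  have hbw : b ≠ w := fun e => hcut.notMem (e ▸ hw)
  have hwA := Finset.mem_of_mem_erase (hcut.2.1.1 hw)
  refine conn_of_base (Finset.mem_erase.2 ⟨hbw, hcut.1⟩) fun Z hZ hbZ => ?_
  by_contra hne
  have hZX : Z ⊆ X := by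
    by_contra h
    obtain ⟨z, hz, hzX⟩ := Finset.not_subset.1 h
    have hzA := Finset.mem_of_mem_erase (hZ.1 hz)
    have hzY : z ∈ Z ∩ (A.erase b \ X) := Finset.mem_inter.2 ⟨hz, Finset.mem_sdiff.2
      ⟨Finset.mem_erase.2 ⟨fun e => hbZ (e ▸ hz), hzA⟩, hzX⟩⟩
    obtain ⟨x, hx, y, hy, hyZ, hxy, h⟩ := hcut.compl.exists_adj_base hA
      (Finset.inter_subset_right (s₁ := Z)) ⟨z, hzY⟩
    have hxZ := (Finset.mem_inter.1 hx).1
    rcases h with rfl | h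
    · exact hbZ (hZ.2 x hxZ y (Finset.mem_erase.2 ⟨hbw, hy⟩) hxy)
    · refine hyZ (Finset.mem_inter.2 ⟨hZ.2 x hxZ y (Finset.mem_erase.2 ⟨?_, hy⟩) hxy, h⟩)
      rintro rfl
      exact (Finset.mem_sdiff.1 h).2 hw
  have hwZ : w ∉ Z := fun h => (Finset.mem_erase.1 (hZ.1 h)).1 rfl
  have h1 := hmin w Z ⟨hwA, hZ, Finset.nonempty_iff_ne_empty.2 hne, fun e =>
    hbZ (e ▸ Finset.mem_erase.2 ⟨hbw, hcut.1⟩)⟩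
  exact hwZ ((Finset.eq_of_subset_of_card_le hZX h1).symm ▸ hw)

/-- If `b` were attached to `X` at one vertex `w` at most, `w` would cut off the smaller set `X -
w`. -/
theorem Cuts.two_le_card_nbrs (hcut : Cuts G A b X)
    (hmin : ∀ c Z, Cuts G A c Z → X.card ≤ Z.card) (hX : 2 ≤ X.card) :
    2 ≤ (nbrs G X b).card := by
  by_contra hlt
  obtain ⟨w, hw, hN⟩ : ∃ w ∈ X, nbrs G X b ⊆ {w} := by
    have : Nonempty V := ⟨b⟩
    obtain ⟨w, hw⟩ := (Finset.card_le_one_iff_subset_singleton (s := nbrs G X b)).1 (by omega)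
    by_cases hwX : w ∈ X
    · exact ⟨w, hwX, hw⟩
    · obtain ⟨u, hu⟩ := hcut.2.2.1
      refine ⟨u, hu, fun y hy => ?_⟩
      have := Finset.mem_singleton.1 (hw hy)
      exact absurd (this ▸ nbrs_subset hy) hwX
  have hbw : b ≠ w := fun e => hcut.notMem (e ▸ hw)
  have hcard := Finset.card_erase_add_one hw
  have h1 := hmin w (X.erase w) ⟨Finset.mem_of_mem_erase (hcut.2.1.1 hw), ⟨fun x hx => ?_,
    fun x hx y hy hxy => ?_⟩, Finset.card_pos.1 (by omega), fun e => ?_⟩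
  · omega
  · rw [Finset.mem_erase] at hx ⊢
    exact ⟨hx.1, Finset.mem_of_mem_erase (hcut.2.1.1 hx.2)⟩
  · rw [Finset.mem_erase] at hx hy ⊢
    refine ⟨hy.1, hcut.2.1.2 x hx.2 y (Finset.mem_erase.2 ⟨?_, hy.2⟩) hxy⟩
    rintro rfl
    exact hx.1 (Finset.mem_singleton.1 (hN (mem_nbrs.2 ⟨hx.2, hxy.symm⟩)))
  · exact hcut.notMem (Finset.mem_of_mem_erase (e ▸ Finset.mem_erase.2 ⟨hbw, hcut.1⟩))

/-- The bound for a connected graph with a cut vertex. -/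
theorem card_maxIndep_le_of_cuts (ih : BoundBelow G A.card) (hA : Conn G A) (hn : 5 ≤ A.card)
    (hcut : Cuts G A b X) (hmin : ∀ c Z, Cuts G A c Z → X.card ≤ Z.card) :
    (maxIndep G A).card ≤ conMax A.card := by
  have hXc := hcut.conn_of_minimal hmin
  have hXA : X ⊆ A := hcut.2.1.1.trans (Finset.erase_subset _ _)
  set Y := A.erase b \ X with hYdef
  have hxy : X.card ≤ Y.card := hmin b Y hcut.compl
  have hcard : X.card + Y.card + 1 = A.card := by
    have h1 := Finset.card_sdiff_add_card_eq_card hcut.2.1.1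
    have h2 := Finset.card_erase_add_one hcut.1
    rw [← hYdef] at h1
    omega
  have hx0 : 1 ≤ X.card := hcut.2.2.1.card_pos
  have hnoedge : ∀ x ∈ X, ∀ y ∈ Y, ¬ G.Adj x y := fun x hx y hy hxy =>
    (Finset.mem_sdiff.1 hy).2 (hcut.2.1.2 x hx y (Finset.mem_sdiff.1 hy).1 hxy)
  have e1 : A.erase b = X ∪ Y := by rw [hYdef, Finset.union_sdiff_of_subset hcut.2.1.1]
  have e2 : far G A b = far G X b ∪ far G Y b := by
    rw [← far_union, ← e1]
    ext y
    simp only [mem_far, Finset.mem_erase]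
    tauto
  have m0 := card_maxIndep_le_erase_add_far (G := G) (A := A) (v := b)
  rw [e1, e2] at m0
  have m1 := card_maxIndep_union_le hnoedge
  have m2 := card_maxIndep_union_le (G := G) (B := far G X b) (C := far G Y b)
    fun x hx y hy => hnoedge x (far_subset hx) y (far_subset hy)
  have main := m0.trans (Nat.add_le_add m1 m2)
  have att : ∀ a, 1 ≤ a → a ≤ 3 → _ := fun a h1 h3 =>
    attached_le ih hA hcut.1 hcut.compl.2.1 h1 h3
  have a1 := att 1 le_rfl (by norm_num)
  have a2 := att 2 (by norm_num) (by norm_num)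
  have a3 := att 3 (by norm_num) le_rfl
  rw [← hYdef, one_mul] at a1
  rw [← hYdef] at a2 a3
  have hP := card_maxIndep_le_moonMoser G Y
  have hp := ih X (by omega) hXc
  have hfar := card_far_add_of_notMem (G := G) hcut.notMem
  have hNb := hcut.two_le_card_nbrs hmin
  have hq : ∀ k, X.card ≤ k + (nbrs G X b).card →
      (maxIndep G (far G X b)).card ≤ moonMoser k :=
    fun k hk => card_maxIndep_le_of_card_le (by omega)
  rw [← hcard]
  generalize hPe : (maxIndep G Y).card = P at *
  generalize hQe : (maxIndep G (far G Y b)).card = Q at *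
  -- Here `p` is at most the size of `X` and `q` at most 1, so `attached_le` with `a` that size is
  -- exactly the bound needed.
  by_cases hx4 : X.card < 4
  · have hsmall : ∀ {p q c : ℕ}, (maxIndep G X).card ≤ p → (maxIndep G (far G X b)).card ≤ q →
        p * P + q * Q ≤ c → (maxIndep G A).card ≤ c := fun h1 h2 h3 =>
      (main.trans (Nat.add_le_add (Nat.mul_le_mul_right P h1) (Nat.mul_le_mul_right Q h2))).trans h3
    rcases (by omega : X.card = 1 ∨ X.card = 2 ∨ X.card = 3) with h | h | h
    · rw [h] at hp hq ⊢
      refine hsmall hp (hq 1 (by omega)) ?_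
      rw [show conMax 1 = 1 from rfl, show moonMoser 1 = 1 from rfl, one_mul, one_mul,
        show 1 + Y.card + 1 = Y.card + 1 + 1 by ring]
      exact a1
    · have := hNb h.ge
      rw [h] at hp hq ⊢
      refine hsmall hp (hq 1 (by omega)) ?_
      rw [show conMax 2 = 2 from rfl, show moonMoser 1 = 1 from rfl, one_mul,
        show 2 + Y.card + 1 = Y.card + 2 + 1 by ring]
      exact a2
    · have := hNb (by omega)
      rw [h] at hp hq ⊢
      refine hsmall hp (hq 1 (by omega)) ?_
      rw [show conMax 3 = 3 from rfl, show moonMoser 1 = 1 from rfl, one_mul,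
        show 3 + Y.card + 1 = Y.card + 3 + 1 by ring]
      exact a3
  have hNb2 := hNb (by omega)
  by_cases hexc : (X.card + Y.card) % 3 = 1 → X.card ≠ 4 ∧ X.card ≠ 6 ∧ X.card ≠ 7
  · refine (main.trans (Nat.add_le_add (Nat.mul_le_mul_right P hp) (Nat.mul_le_mul_right Q
      (hq (X.card - 2) (by omega))))).trans ?_
    exact leaf_le (by omega) hxy hexc a1 a2
  have hmod : (X.card + Y.card) % 3 = 1 := by
    by_contra h
    exact hexc fun h' => absurd h' h
  have hx467 : X.card = 4 ∨ X.card = 6 ∨ X.card = 7 := by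
    by_contra h
    exact hexc fun _ => by omega
  by_cases hb3 : 3 ≤ (nbrs G X b).card
  · exact main.trans (special_leaf_le hx467 hxy hmod hP a1 a2
      (.inl ⟨hp, hq (X.card - 3) (by omega)⟩))
  by_cases hleaf : ∃ p ∈ X, (nbrs G X p).card ≤ 1
  · obtain ⟨p, hp', hleaf⟩ := hleaf
    exact main.trans (special_leaf_le hx467 hxy hmod hP a1 a2
      (.inr ⟨card_maxIndep_le_of_card_nbrs_le_one hXc (by omega) hp' hleaf,
        hq (X.card - 2) (by omega)⟩))
  push Not at hleaf
  rw [hcard]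
  -- What remains: `b` has exactly two neighbours in `X` and `X` has no leaf. Some `v` in `X` then
  -- misses `b`, hence all of the connected set `A \ X`.
  obtain ⟨v, hv, hvN⟩ := Finset.exists_of_ssubset (Finset.ssubset_iff_subset_ne.2
    ⟨nbrs_subset (G := G) (A := X) (v := b), fun e => by rw [e] at hb3; omega⟩)
  refine card_maxIndep_le_of_inner (X := X) (v := v) (C := A \ X) ih hA hn hXA
    (fun w hw => hcut.conn_erase_of_minimal hA hmin hw) ?_ hv (hcut.conn_sdiff hA) ?_ subset_rfl
  -- A vertex of degree at most 2 adjacent to `b` would be a leaf of `X`.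
  · intro w hw h2 y hy
    rw [mem_nbrs] at hy
    by_contra hyX
    have hyb : y = b := by
      by_contra h
      exact hyX (hcut.2.1.2 w hw y (Finset.mem_erase.2 ⟨h, hy.1⟩) hy.2)
    have hsub : insert y (nbrs G X w) ⊆ nbrs G A w := by
      refine Finset.insert_subset (mem_nbrs.2 hy) fun z hz => ?_
      rw [mem_nbrs] at hz
      exact mem_nbrs.2 ⟨hXA hz.1, hz.2⟩
    have h3 := Finset.card_le_card hsub
    rw [Finset.card_insert_of_notMem fun h => hyX (nbrs_subset h)] at h3
    have := hleaf w hw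
    omega
  · intro y hy
    rw [Finset.mem_sdiff] at hy
    refine mem_far.2 ⟨hy.1, fun e => hy.2 (e ▸ hv), fun hvy => ?_⟩
    by_cases h : y = b
    · subst h
      exact hvN (mem_nbrs.2 ⟨hv, hvy.symm⟩)
    · exact hy.2 (hcut.2.1.2 v hv y (Finset.mem_erase.2 ⟨h, hy.1⟩) hvy)

/-- The theorem of Griggs, Grinstead and Guichard: the maximal number of maximal independent sets
of a connected graph. -/
theorem card_maxIndep_le_conMax (G : SimpleGraph V) (A : Finset V) (hA : Conn G A) :
    (maxIndep G A).card ≤ conMax A.card := by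
  induction hk : A.card using Nat.strong_induction_on generalizing A with
  | _ n ihn =>
    subst hk
    have ih : BoundBelow G A.card := fun B hB hBc => ihn _ hB B hBc rfl
    by_cases hn : A.card < 5
    · have h0 := hA.1.card_pos
      refine (card_maxIndep_le_moonMoser G A).trans ?_
      interval_cases A.card <;> decide
    push Not at hn
    by_cases hcut : ∃ b X, Cuts G A b X
    · obtain ⟨b, X, hcut⟩ := hcut
      obtain ⟨⟨b, X⟩, hmem, hmin⟩ := Finset.exists_min_image
        ((A ×ˢ A.powerset).filter fun z => Cuts G A z.1 z.2) (fun z => z.2.card)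
        ⟨(b, X), Finset.mem_filter.2 ⟨Finset.mem_product.2 ⟨hcut.1, Finset.mem_powerset.2
          (hcut.2.1.1.trans (Finset.erase_subset _ _))⟩, hcut⟩⟩
      refine card_maxIndep_le_of_cuts ih hA hn (Finset.mem_filter.1 hmem).2 fun c Z hZ =>
        hmin (c, Z) (Finset.mem_filter.2 ⟨Finset.mem_product.2 ⟨hZ.1, Finset.mem_powerset.2
          (hZ.2.1.1.trans (Finset.erase_subset _ _))⟩, hZ⟩)
    have hnc : ∀ w ∈ A, Conn G (A.erase w) := by
      intro w hw
      refine ⟨Finset.card_pos.1 (by rw [Finset.card_erase_of_mem hw]; omega), fun B hB hne => ?_⟩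
      by_contra h
      exact hcut ⟨w, B, hw, hB, hne, h⟩
    obtain ⟨v, hv⟩ := hA.1
    -- Without cut vertices `X` is everything, so any single vertex missed by `v` serves as the
    -- connected set.
    rcases (far G A v).eq_empty_or_nonempty with he | ⟨u, hu⟩
    · refine (card_maxIndep_le_of_noncut ih hv (hnc v hv)).trans
        (le_trans (Nat.add_le_add_left ?_ _) (noncut_four_le hn))
      exact card_maxIndep_le_of_card_le (by rw [he]; simp)
    · exact card_maxIndep_le_of_inner (X := A) (v := v) (C := {u}) ih hA hn subset_rfl hnc
        (fun _ _ _ => nbrs_subset) hv conn_singleton (Finset.singleton_subset_iff.2 hu) (by simp)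

end Extremal

/-! ### From frameworks to graphs: the upper bound. -/

namespace AF

open Extremal

variable {𝔄 : Type*} {F : AF 𝔄} {S T : Finset 𝔄}

theorem cf_of_subset (hT : T ∈ F.cf) (h : S ⊆ T) : S ∈ F.cf :=
  ⟨h.trans hT.1, fun a ha b hb => hT.2 a (h ha) b (h hb)⟩

/-- A new element of `T` is not attacked by `S`, so it is new in the range too. Range-maximal sets
are therefore inclusion-maximal. -/
theorem range_ssubset_range (hT : T ∈ F.cf) (h : S ⊂ T) : F.range S ⊂ F.range T := by
  obtain ⟨t, htT, htS⟩ := Finset.exists_of_ssubset h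
  refine ⟨fun b hb => ?_, fun hsub => ?_⟩
  · rcases hb with hb | ⟨s, hs, hsb⟩
    · exact .inl (h.1 hb)
    · exact .inr ⟨s, h.1 hs, hsb⟩
  · rcases hsub (.inl htT : t ∈ F.range T) with ht | ⟨s, hs, hst⟩
    · exact htS ht
    · exact hT.2 s (h.1 hs) t htT hst

theorem range_subset_args (hS : S ∈ F.cf) : F.range S ⊆ F.args := by
  rintro b (hb | ⟨s, -, hsb⟩)
  · exact hS.1 hb
  · exact (F.attacks_subset _ hsb).2

theorem args_subset_range (hS : S ∈ F.stb) : (F.args : Set 𝔄) ⊆ F.range S := fun a ha => by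
  by_cases h : a ∈ S
  · exact .inl h
  · exact .inr (hS.2 a ha h)

theorem naive_of_stb (hS : S ∈ F.stb) : S ∈ F.naive := by
  refine ⟨hS.1, ?_⟩
  rintro ⟨T, hT, hST⟩
  exact (range_ssubset_range hT hST).2 ((range_subset_args hT).trans (args_subset_range hS))

theorem naive_of_stage (hS : S ∈ F.stage) : S ∈ F.naive :=
  ⟨hS.1, fun ⟨T, hT, hST⟩ => hS.2 ⟨T, hT, range_ssubset_range hT hST⟩⟩

theorem pref_of_sem (hS : S ∈ F.sem) : S ∈ F.pref :=
  ⟨hS.1, fun ⟨T, hT, hST⟩ => hS.2 ⟨T, hT, range_ssubset_range hT.1 hST⟩⟩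

/-- A set that is both stable and admissible is an extension for all five semantics. -/
theorem mem_extensions_of_stb_of_adm (σ : Semantics) (hS : S ∈ F.stb) (hS' : S ∈ F.adm) :
    S ∈ σ.extensions F := by
  have hr : ∀ T ∈ F.cf, ¬ F.range S ⊂ F.range T := fun T hT h =>
    h.2 ((range_subset_args hT).trans (args_subset_range hS))
  cases σ
  · exact naive_of_stb hS
  · exact hS
  · exact ⟨hS.1, fun ⟨T, hT, h⟩ => hr T hT h⟩
  · exact ⟨hS', fun ⟨T, hT, h⟩ => hr T hT.1 h⟩
  · exact ⟨hS', fun ⟨T, hT, h⟩ => (naive_of_stb hS).2 ⟨T, hT.1, h⟩⟩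

theorem exists_naive_superset (hS : S ∈ F.cf) : ∃ T ∈ F.naive, S ⊆ T := by
  classical
  obtain ⟨T, hT, hmax⟩ := Finset.exists_max_image
    (F.args.powerset.filter fun T => T ∈ F.cf ∧ S ⊆ T) Finset.card
    ⟨S, Finset.mem_filter.2 ⟨Finset.mem_powerset.2 hS.1, hS, subset_rfl⟩⟩
  rw [Finset.mem_filter] at hT
  refine ⟨T, ⟨hT.2.1, ?_⟩, hT.2.2⟩
  rintro ⟨U, hU, hTU⟩
  have h1 := hmax U (Finset.mem_filter.2 ⟨Finset.mem_powerset.2 hU.1, hU, hT.2.2.trans hTU.1⟩)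
  exact absurd (Finset.card_lt_card hTU) (by omega)

/-- The union is conflict-free inside `U` and still defends its elements, so it is admissible and
both maximal sets equal it. -/
theorem eq_of_pref_of_subset_cf {U : Finset 𝔄} (hS : S ∈ F.pref) (hT : T ∈ F.pref) (hU : U ∈ F.cf)
    (hSU : S ⊆ U) (hTU : T ⊆ U) : S = T := by
  classical
  have hadm : S ∪ T ∈ F.adm := by
    refine ⟨cf_of_subset hU (Finset.union_subset hSU hTU), fun a ha b hb hba => ?_⟩
    rcases Finset.mem_union.1 ha with h | h
    · obtain ⟨s, hs, hsb⟩ := hS.1.2 a h b hb hba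
      exact ⟨s, Finset.mem_union_left _ hs, hsb⟩
    · obtain ⟨s, hs, hsb⟩ := hT.1.2 a h b hb hba
      exact ⟨s, Finset.mem_union_right _ hs, hsb⟩
  have h1 : S = S ∪ T := by
    by_contra h
    exact hS.2 ⟨_, hadm, Finset.ssubset_iff_subset_ne.2 ⟨Finset.subset_union_left, h⟩⟩
  have h2 : T = S ∪ T := by
    by_contra h
    exact hT.2 ⟨_, hadm, Finset.ssubset_iff_subset_ne.2 ⟨Finset.subset_union_right, h⟩⟩
  exact h1.trans h2.symm

theorem ncard_extensions_le_ncard_naive (σ : Semantics) (F : AF 𝔄) :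
    (σ.extensions F).ncard ≤ F.naive.ncard := by
  have hfin : F.naive.Finite := Semantics.extensions_finite .naive F
  have hpref : ∀ E : Set (Finset 𝔄), E ⊆ F.pref → E.ncard ≤ F.naive.ncard := by
    intro E hE
    have : ∀ S : Finset 𝔄, ∃ T, S ∈ F.pref → T ∈ F.naive ∧ S ⊆ T := fun S => by
      by_cases h : S ∈ F.pref
      · obtain ⟨T, hT⟩ := exists_naive_superset h.1.1
        exact ⟨T, fun _ => hT⟩
      · exact ⟨S, fun h' => absurd h' h⟩
    choose f hf using this
    refine Set.ncard_le_ncard_of_injOn f (fun S hS => (hf S (hE hS)).1) ?_ hfin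
    intro S hS T hT h
    have h1 := hf S (hE hS)
    exact eq_of_pref_of_subset_cf (hE hS) (hE hT) h1.1.1 h1.2 (h ▸ (hf T (hE hT)).2)
  cases σ
  · exact le_rfl
  · exact Set.ncard_le_ncard (fun S hS => naive_of_stb hS) hfin
  · exact Set.ncard_le_ncard (fun S hS => naive_of_stage hS) hfin
  · exact hpref _ fun S hS => pref_of_sem hS
  · exact hpref _ subset_rfl

/-- The undirected loopless graph of the attack relation, on the whole domain. -/
def attackGraph (F : AF 𝔄) : SimpleGraph 𝔄 :=
  SimpleGraph.fromRel fun a b => (a, b) ∈ F.attacks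

open Classical in
/-- The arguments that do not attack themselves. -/
noncomputable def loopless (F : AF 𝔄) : Finset 𝔄 :=
  F.args.filter fun a => (a, a) ∉ F.attacks

theorem mem_maxIndep_of_naive (hS : S ∈ F.naive) : S ∈ maxIndep F.attackGraph F.loopless := by
  classical
  refine mem_maxIndep.2 ⟨fun a ha => Finset.mem_filter.2 ⟨hS.1.1 ha, hS.1.2 a ha a ha⟩,
    fun a ha b hb hab => ?_, fun a ha haS => ?_⟩
  · rcases hab.2 with h | h
    · exact hS.1.2 a ha b hb h
    · exact hS.1.2 b hb a ha h
  · rw [loopless, Finset.mem_filter] at ha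
    by_contra hno
    push Not at hno
    have hn : ∀ b ∈ S, (a, b) ∉ F.attacks ∧ (b, a) ∉ F.attacks := fun b hb => by
      have hne : a ≠ b := fun e => haS (e ▸ hb)
      exact ⟨fun h => hno b hb ⟨hne, .inl h⟩, fun h => hno b hb ⟨hne, .inr h⟩⟩
    refine hS.2 ⟨insert a S, ⟨Finset.insert_subset ha.1 hS.1.1, fun x hx y hy => ?_⟩,
      Finset.ssubset_insert haS⟩
    rcases Finset.mem_insert.1 hx with rfl | hx' <;> rcases Finset.mem_insert.1 hy with rfl | hy'
    · exact ha.2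
    · exact (hn y hy').1
    · exact (hn x hx').2
    · exact hS.1.2 x hx' y hy'

theorem conn_of_connected (h : F.Connected) : Conn F.attackGraph F.args := by
  refine ⟨F.args_nonempty, fun B hB ⟨x, hx⟩ => hB.1.antisymm fun y hy => ?_⟩
  have key : ∀ u v : {a : 𝔄 // a ∈ F.args}, F.underlying.Walk u v → u.1 ∈ B → v.1 ∈ B := by
    intro u v p
    induction p with
    | nil => exact id
    | cons hadj _ ih =>
      exact fun hu => ih (hB.2 _ hu _ (Subtype.prop _) ⟨fun e => hadj.1 (Subtype.ext e), hadj.2⟩)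
  obtain ⟨p⟩ := h.preconnected ⟨x, hB.1 hx⟩ ⟨y, hy⟩
  exact key _ _ p hx

theorem ncard_extensions_le (σ : Semantics) (h : F.Connected) :
    (σ.extensions F).ncard ≤ conMax F.args.card := by
  classical
  refine (ncard_extensions_le_ncard_naive σ F).trans ?_
  have h1 : F.naive.ncard ≤ (maxIndep F.attackGraph F.loopless).card := by
    rw [← Set.ncard_coe_finset]
    exact Set.ncard_le_ncard (fun S hS => mem_maxIndep_of_naive hS) (Finset.finite_toSet _)
  refine h1.trans ?_
  have hsub : F.loopless ⊆ F.args := Finset.filter_subset _ _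
  by_cases e : F.loopless = F.args
  · rw [e]
    exact card_maxIndep_le_conMax _ _ (conn_of_connected h)
  · have hlt := Finset.card_lt_card (Finset.ssubset_iff_subset_ne.2 ⟨hsub, e⟩)
    obtain ⟨k, hk⟩ := Nat.exists_eq_add_of_lt hlt
    refine (card_maxIndep_le_moonMoser _ _).trans ((moonMoser_le_conMax_succ _).trans
      (conMax_mono (by omega)))

/-! ### Symmetric frameworks built from graphs. -/

section OfGraph

variable {V : Type*} (G : SimpleGraph V) (A : Finset V) (hA : A.Nonempty) (e : V ↪ 𝔄)

/-- The symmetric framework given by a finite set of vertices of a graph. -/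
def ofGraph : AF 𝔄 where
  args := A.map e
  attacks := {z | ∃ x ∈ A, ∃ y ∈ A, G.Adj x y ∧ z = (e x, e y)}
  args_nonempty := hA.map
  attacks_subset := by
    rintro _ ⟨x, hx, y, hy, -, rfl⟩
    exact ⟨Finset.mem_map_of_mem e hx, Finset.mem_map_of_mem e hy⟩

variable {G A hA e}

theorem mem_attacks_ofGraph {x y : V} (hx : x ∈ A) (hy : y ∈ A) :
    (e x, e y) ∈ (ofGraph G A hA e).attacks ↔ G.Adj x y := by
  constructor
  · rintro ⟨x', -, y', -, h, he⟩
    rw [Prod.mk.injEq] at he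
    rw [e.injective he.1, e.injective he.2]
    exact h
  · exact fun h => ⟨x, hx, y, hy, h, rfl⟩

/-- Maximality gives stability, and symmetry makes every attacked element strike back, which gives
admissibility. -/
theorem map_mem_extensions_ofGraph (σ : Semantics) {S : Finset V} (hS : S ∈ maxIndep G A) :
    S.map e ∈ σ.extensions (ofGraph G A hA e) := by
  obtain ⟨h1, h2, h3⟩ := mem_maxIndep.1 hS
  have hcf : S.map e ∈ (ofGraph G A hA e).cf := by
    refine ⟨Finset.map_subset_map.2 h1, fun a ha b hb => ?_⟩
    obtain ⟨x, hx, rfl⟩ := Finset.mem_map.1 ha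
    obtain ⟨y, hy, rfl⟩ := Finset.mem_map.1 hb
    rw [mem_attacks_ofGraph (h1 hx) (h1 hy)]
    exact h2 x hx y hy
  refine mem_extensions_of_stb_of_adm σ ⟨hcf, fun a ha haS => ?_⟩ ⟨hcf, fun a ha b hb hba => ?_⟩
  · obtain ⟨x, hx, rfl⟩ := Finset.mem_map.1 ha
    obtain ⟨y, hy, hxy⟩ := h3 x hx fun h => haS (Finset.mem_map_of_mem e h)
    exact ⟨e y, Finset.mem_map_of_mem e hy, (mem_attacks_ofGraph (h1 hy) hx).2 hxy.symm⟩
  · obtain ⟨x, hx, rfl⟩ := Finset.mem_map.1 ha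
    obtain ⟨y, hy, rfl⟩ := Finset.mem_map.1 hb
    exact ⟨e x, ha, (mem_attacks_ofGraph (h1 hx) hy).2
      ((mem_attacks_ofGraph hy (h1 hx)).1 hba).symm⟩

theorem connected_ofGraph (hc : Conn G A) : (ofGraph G A hA e).Connected := by
  classical
  have hmem : ∀ {x}, x ∈ A → e x ∈ (ofGraph G A hA e).args := fun hx => Finset.mem_map_of_mem e hx
  have key : ∀ x y (hx : x ∈ A) (hy : y ∈ A), (ofGraph G A hA e).underlying.Reachable
      ⟨e x, hmem hx⟩ ⟨e y, hmem hy⟩ := by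
    intro x y hx hy
    have := hc.2 (A.filter fun z => ∃ hz : z ∈ A, (ofGraph G A hA e).underlying.Reachable
      ⟨e x, hmem hx⟩ ⟨e z, hmem hz⟩) ⟨Finset.filter_subset _ _, fun u hu v hv huv => ?_⟩
      ⟨x, Finset.mem_filter.2 ⟨hx, hx, SimpleGraph.Reachable.refl _⟩⟩
    · rw [← this, Finset.mem_filter] at hy
      exact hy.2.2
    · obtain ⟨huA, _, hr⟩ := Finset.mem_filter.1 hu
      refine Finset.mem_filter.2 ⟨hv, hv, hr.trans (SimpleGraph.Adj.reachable ⟨fun h => ?_,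
        .inl ((mem_attacks_ofGraph huA hv).2 huv)⟩)⟩
      exact huv.ne (e.injective (congrArg Subtype.val h))
  have hpre : (ofGraph G A hA e).underlying.Preconnected := by
    rintro ⟨a, ha⟩ ⟨b, hb⟩
    obtain ⟨x, hx, rfl⟩ := Finset.mem_map.1 ha
    obtain ⟨y, hy, rfl⟩ := Finset.mem_map.1 hb
    exact key x y hx hy
  obtain ⟨x, hx⟩ := hA
  have : Nonempty {a : 𝔄 // a ∈ (ofGraph G A ⟨x, hx⟩ e).args} := ⟨⟨e x, hmem hx⟩⟩
  exact ⟨hpre⟩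

theorem card_maxIndep_le_ncard_extensions (σ : Semantics) :
    (maxIndep G A).card ≤ (σ.extensions (ofGraph G A hA e)).ncard := by
  rw [← Set.ncard_coe_finset]
  exact Set.ncard_le_ncard_of_injOn (fun S => S.map e)
    (fun S hS => map_mem_extensions_ofGraph σ hS)
    (fun S _ T _ h => Finset.map_injective e h) (Semantics.extensions_finite σ _)

end OfGraph

end AF

/-! ### Extremal graphs and the final formula. -/

namespace Extremal

open Classical

variable {ι : Type*} [Fintype ι]

/-- Disjoint cliques indexed by `Option ι`, where the vertex `0` of the clique `none` is joined to
the vertices `0` of all the others. -/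
def cliqueStar (ι : Type*) : SimpleGraph (Σ _ : Option ι, ℕ) where
  Adj x y := (x.1 = y.1 ∧ x.2 ≠ y.2) ∨
    (x.1 ≠ y.1 ∧ x.2 = 0 ∧ y.2 = 0 ∧ (x.1 = none ∨ y.1 = none))
  symm := ⟨fun x y h => by
    rcases h with ⟨h1, h2⟩ | ⟨h1, h2, h3, h4⟩
    · exact .inl ⟨h1.symm, h2.symm⟩
    · exact .inr ⟨h1.symm, h3, h2, h4.symm⟩⟩
  loopless := ⟨fun x h => by rcases h with h | h <;> simp at h⟩

/-- The vertices of cliques with `d i` vertices. -/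
def cliqueStarVerts (d : Option ι → ℕ) : Finset (Σ _ : Option ι, ℕ) :=
  Finset.univ.sigma fun i => Finset.range (d i)

variable {d : Option ι → ℕ}

theorem mem_cliqueStarVerts {x : Σ _ : Option ι, ℕ} : x ∈ cliqueStarVerts d ↔ x.2 < d x.1 := by
  simp [cliqueStarVerts]

theorem card_cliqueStarVerts : (cliqueStarVerts d).card = d none + ∑ i, d (some i) := by
  simp [cliqueStarVerts, Fintype.sum_option]

theorem conn_cliqueStar (hd : ∀ i, 0 < d i) : Conn (cliqueStar ι) (cliqueStarVerts d) := by
  have h0 : ∀ i, (⟨i, 0⟩ : Σ _ : Option ι, ℕ) ∈ cliqueStarVerts d := fun i =>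
    mem_cliqueStarVerts.2 (hd i)
  refine conn_of_base (h0 none) fun B hB hp => ?_
  by_contra hne
  obtain ⟨⟨i, j⟩, hx⟩ := Finset.nonempty_iff_ne_empty.2 hne
  have hi : (⟨i, 0⟩ : Σ _ : Option ι, ℕ) ∈ B := by
    by_cases hj : j = 0
    · exact hj ▸ hx
    · exact hB.2 _ hx _ (h0 i) (.inl ⟨rfl, hj⟩)
  by_cases hn : i = none
  · exact hp (hn ▸ hi)
  · exact hp (hB.2 _ hi _ (h0 none) (.inr ⟨hn, rfl, rfl, .inr rfl⟩))

/-- The set that contains the vertex `f i` of the clique `i`. -/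
def transversal (f : Option ι → ℕ) : Finset (Σ _ : Option ι, ℕ) :=
  Finset.univ.sigma fun i => {f i}

theorem mem_transversal {f : Option ι → ℕ} {x : Σ _ : Option ι, ℕ} :
    x ∈ transversal f ↔ x.2 = f x.1 := by
  simp [transversal]

/-- One vertex per clique dominates everything, and only two chosen vertices numbered 0, one of them
in the central clique, can be adjacent. -/
theorem transversal_mem_maxIndep {f : Option ι → ℕ} (hf : ∀ i, f i < d i)
    (h : f none ≠ 0 ∨ ∀ i, f (some i) ≠ 0) :
    transversal f ∈ maxIndep (cliqueStar ι) (cliqueStarVerts d) := by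
  refine mem_maxIndep.2 ⟨fun x hx => ?_, fun x hx y hy hxy => ?_, fun x hx hxf => ?_⟩
  · rw [mem_transversal] at hx
    exact mem_cliqueStarVerts.2 (hx ▸ hf x.1)
  · rw [mem_transversal] at hx hy
    rcases hxy with ⟨h1, h2⟩ | ⟨h1, h2, h3, h4⟩
    · exact h2 (by rw [hx, hy, h1])
    · have hsome : ∀ {u v : Option ι}, u ≠ v → u = none → f u = 0 → f v = 0 → False := by
        rintro _ (_ | i) huv rfl hu hv
        · exact huv rfl
        · exact h.elim (fun h => h hu) (fun h => h i hv)
      rw [hx] at h2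
      rw [hy] at h3
      rcases h4 with h4 | h4
      · exact hsome h1 h4 h2 h3
      · exact hsome h1.symm h4 h3 h2
  · rw [mem_transversal] at hxf
    exact ⟨⟨x.1, f x.1⟩, mem_transversal.2 rfl, .inl ⟨rfl, hxf⟩⟩

/-- The first summand counts transversals avoiding the centre; the second those through it, which
must avoid all other vertices numbered 0. -/
theorem le_card_maxIndep_cliqueStar (hd : ∀ i, 0 < d i) :
    (d none - 1) * ∏ i, d (some i) + ∏ i, (d (some i) - 1) ≤
      (maxIndep (cliqueStar ι) (cliqueStarVerts d)).card := by
  let s : Option ι → Finset ℕ := fun i =>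
    i.elim ((Finset.range (d none)).erase 0) fun k => Finset.range (d (some k))
  let t : Option ι → Finset ℕ := fun i =>
    i.elim {0} fun k => (Finset.range (d (some k))).erase 0
  have hc : ∀ i, ((Finset.range (d i)).erase 0).card = d i - 1 := fun i => by
    rw [Finset.card_erase_of_mem (Finset.mem_range.2 (hd i)), Finset.card_range]
  have hdisj : Disjoint (Fintype.piFinset s) (Fintype.piFinset t) := by
    rw [Finset.disjoint_left]
    intro f hf hf'
    have h1 := Fintype.mem_piFinset.1 hf none
    have h2 := Fintype.mem_piFinset.1 hf' none
    exact (Finset.mem_erase.1 h1).1 (Finset.mem_singleton.1 h2)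
  have hcard : (Fintype.piFinset s ∪ Fintype.piFinset t).card =
      (d none - 1) * ∏ i, d (some i) + ∏ i, (d (some i) - 1) := by
    rw [Finset.card_union_of_disjoint hdisj, Fintype.card_piFinset, Fintype.card_piFinset,
      Fintype.prod_option, Fintype.prod_option]
    simp [s, t, hc]
  rw [← hcard]
  refine Finset.card_le_card_of_injOn transversal (fun f hf => ?_) ?_
  · rcases Finset.mem_union.1 (Finset.mem_coe.1 hf) with h | h <;> rw [Fintype.mem_piFinset] at h
    · refine transversal_mem_maxIndep (fun i => ?_) (.inl (Finset.mem_erase.1 (h none)).1)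
      rcases i with _ | i
      · exact Finset.mem_range.1 (Finset.mem_erase.1 (h none)).2
      · exact Finset.mem_range.1 (h (some i))
    · refine transversal_mem_maxIndep (fun i => ?_)
        (.inr fun i => (Finset.mem_erase.1 (h (some i))).1)
      rcases i with _ | i
      · rw [Finset.mem_singleton.1 (h none)]
        exact hd none
      · exact Finset.mem_range.1 (Finset.mem_erase.1 (h (some i))).2
  · intro f _ g _ hfg
    funext i
    have : (⟨i, f i⟩ : Σ _ : Option ι, ℕ) ∈ transversal g := hfg ▸ mem_transversal.2 rfl
    exact mem_transversal.1 this

/-- Every value of `conMax` is attained by a star of cliques. -/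
theorem exists_cliqueStar {n : ℕ} (hn : 1 ≤ n) :
    ∃ (t : ℕ) (d : Option (Fin t) → ℕ), (∀ i, 0 < d i) ∧ (cliqueStarVerts d).card = n ∧
      conMax n ≤ (d none - 1) * ∏ i, d (some i) + ∏ i, (d (some i) - 1) := by
  by_cases h5 : n ≤ 5
  · refine ⟨0, fun _ => n, fun _ => hn, by simp [card_cliqueStarVerts], ?_⟩
    simp [conMax, h5]
    omega
  -- By residue 0, 1, 2: all triangles; a central 4-clique with triangles; a central 4-clique with
  -- one more 4-clique and triangles.
  obtain ⟨i, rfl | rfl | rfl⟩ := exists_of_six_le (by omega : 6 ≤ n)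
  · refine ⟨i + 1, fun _ => 3, fun _ => by norm_num, ?_, ?_⟩
    · simp [card_cliqueStarVerts]; ring
    · simp [conMax_add_mul, pow_succ]; omega
  · refine ⟨i + 1, fun k => k.elim 4 fun _ => 3, fun k => by cases k <;> simp, ?_, ?_⟩
    · simp [card_cliqueStarVerts]; ring
    · simp [conMax_add_mul, pow_succ]; omega
  · refine ⟨i + 1, fun k => k.elim 4 (Fin.cons 4 fun _ => 3), fun k => ?_, ?_, ?_⟩
    · rcases k with _ | k
      · simp
      · refine Fin.cases ?_ (fun k => ?_) k <;> simp
    · simp [card_cliqueStarVerts, Fin.sum_univ_succ]; ring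
    · simp [conMax_add_mul, Fin.prod_univ_succ]; omega

theorem isGreatest_conCounts (𝔄 : Type*) [Infinite 𝔄] (σ : Semantics) {n : ℕ} (hn : 1 ≤ n) :
    IsGreatest (conCounts 𝔄 σ n) (conMax n) := by
  have hub : conMax n ∈ upperBounds (conCounts 𝔄 σ n) := by
    rintro _ ⟨F, rfl, hc, rfl⟩
    exact AF.ncard_extensions_le σ hc
  refine ⟨?_, hub⟩
  obtain ⟨t, d, hd, hcard, hle⟩ := exists_cliqueStar hn
  have hconn := conn_cliqueStar hd
  let e : (Σ _ : Option (Fin t), ℕ) ↪ 𝔄 :=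
    (Encodable.encode' _).trans (Infinite.natEmbedding 𝔄)
  have hF : (AF.ofGraph (cliqueStar (Fin t)) (cliqueStarVerts d) hconn.1 e).args.card = n := by
    rw [← hcard]
    exact Finset.card_map e
  have hFc := AF.connected_ofGraph (hA := hconn.1) (e := e) hconn
  refine ⟨_, hF, hFc, le_antisymm (hub ⟨_, hF, hFc, rfl⟩) ?_⟩
  exact hle.trans ((le_card_maxIndep_cliqueStar hd).trans
    (AF.card_maxIndep_le_ncard_extensions σ))

theorem sigmaMaxCon_eq (𝔄 : Type*) [Infinite 𝔄] (σ : Semantics) (n : ℕ) :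
    sigmaMaxCon 𝔄 σ n = conMax n := by
  rcases Nat.eq_zero_or_pos n with rfl | hn
  · have : conCounts 𝔄 σ 0 = ∅ := by
      rw [Set.eq_empty_iff_forall_notMem]
      rintro _ ⟨F, h0, -⟩
      exact F.args_nonempty.ne_empty (Finset.card_eq_zero.1 h0)
    -- The supremum of the empty set of naturals is 0, matching the convention for `n = 0`.
    rw [sigmaMaxCon, this, csSup_empty]
    rfl
  · exact (isGreatest_conCounts 𝔄 σ hn).csSup_eq

end Extremal

theorem theorem3 (𝔄 : Type*) [Countable 𝔄] [Infinite 𝔄] (σ : Semantics) :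
    -- for n ≥ 1 the maximum is attained (it is a genuine maximum, not just a supremum)
    (∀ n : ℕ, 1 ≤ n → IsGreatest (conCounts 𝔄 σ n) (sigmaMaxCon 𝔄 σ n)) ∧
    -- the closed formula
    (∀ n : ℕ, n ≤ 5 → sigmaMaxCon 𝔄 σ n = n) ∧
    (∀ n s : ℕ, 6 ≤ n → n = 3 * s →
      sigmaMaxCon 𝔄 σ n = 2 * 3 ^ (s - 1) + 2 ^ (s - 1)) ∧
    (∀ n s : ℕ, 6 ≤ n → n = 3 * s + 1 →
      sigmaMaxCon 𝔄 σ n = 3 ^ s + 2 ^ (s - 1)) ∧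
    (∀ n s : ℕ, 6 ≤ n → n = 3 * s + 2 →
      sigmaMaxCon 𝔄 σ n = 4 * 3 ^ (s - 1) + 3 * 2 ^ (s - 2)) := by
  simp only [Extremal.sigmaMaxCon_eq]
  refine ⟨fun n hn => Extremal.isGreatest_conCounts 𝔄 σ hn, fun n hn => if_pos hn, ?_, ?_, ?_⟩
  · intro n s hn h
    rw [conMax, if_neg (by omega), if_pos (by omega), show n / 3 = s by omega]
  · intro n s hn h
    rw [conMax, if_neg (by omega), if_neg (by omega), if_pos (by omega), show n / 3 = s by omega]
  · intro n s hn h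
    rw [conMax, if_neg (by omega), if_neg (by omega), if_neg (by omega), show n / 3 = s by omega]
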